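/- Let $\alpha_1>0$ and let $v_1:(0,\infty)\to\mathbb C$ be measurable with $\int_0^\infty(1+x^2)|v_1(x)|^2\,dx<\infty$. For real $\lambda$ put $\tilde v_1(\lambda)=\int_0^\infty e^{-i\lambda x}v_1(x)\,dx$, $W_1(\lambda)=\tilde v_1(\lambda)-\tilde v_1(-\lambda)$, $g(y)=\int_0^\infty\overline{v_1(x+y)}\,v_1(x)\,dx$, $\Phi(\lambda)=\int_0^\infty e^{-i\lambda y}g(y)\,dy$, $$r(\lambda)=\overline{\Phi(\lambda)}+\Phi(-\lambda)-\overline{\tilde v_1(\lambda)}\,\tilde v_1(-\lambda)-\frac{2i\lambda}{\alpha_1},$$ and for real $\lambda\neq0$ put $B_1^-(\lambda)=1-\frac{\alpha_1}{2i\lambda}\bigl\{\tilde v_1(\lambda)\overline{\tilde v_1(-\lambda)}-\overline{\Phi(-\lambda)}-\Phi(\lambda)\bigr\}$. Let $S_1(\lambda)=e(-\lambda,0)/e(\lambda,0)$ ($\lambda\in\mathbb R\setminus\{0\}$) be the scattering function of $$-y''(x)+\alpha_1v_1(x)\int_0^\infty y(t)\overline{v_1(t)}\,dt=\lambda^2y(x)\quad(x>0),\qquad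 y(0)=0,$$ where $e(\lambda,x)=e^{i\lambda x}(\alpha_1\varphi(\lambda)-1)-\alpha_1\overline{\tilde v_1(\lambda)}\,\psi(\lambda,x)$ is the Jost solution, $\psi(\lambda,x)=\int_x^\infty\frac{\sin\lambda(t-x)}{\lambda}v_1(t)\,dt$ and $\varphi(\lambda)=\int_0^\infty\psi(\lambda,x)\overline{v_1(x)}\,dx$. Assume that $r$ has no zeros in $\mathbb R\setminus\{0\}$. Then there is exactly one continuous function $\zeta:\mathbb R\to\mathbb R$ with $\zeta(\lambda)\to0$ as $|\lambda|\to\infty$ and $S_1(\lambda)=e^{-2i\zeta(\lambda)}$ for all real $\lambda\ne0$. It satisfies $B_1^-(\lambda)=|B_1^-(\lambda)|e^{-i\zeta(\lambda)}$ for all real $\lambda\neq 0$, the principal value $\mathrm{p.v.}\!\int_{\mathbb R}\frac{\zeta(t)}{t-\lambda}\,dt$ exists for every $\lambda\in\mathbb R$, and $$|W_1(\lambda)|^2=\frac{4\lambda}{\alpha_1}\,\sin\zeta(\lambda)\,\exp\Bigl\{\frac1\pi\,\mathrm{p.v.}\!\int_{\mathbb R}\frac{\zeta(t)}{t-\lambda}\,dt\Bigr\}\qquad(\lambda\in\mathbb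 R).$$ If moreover $\int_0^\infty|v_1(x)|^2\,dx=1$, then the integral below converges absolutely and $$\alpha_1=\frac2\pi\int_0^\infty\lambda\,\sin\zeta(\lambda)\,\exp\Bigl\{\frac1\pi\,\mathrm{p.v.}\!\int_{\mathbb R}\frac{\zeta(t)}{t-\lambda}\,dt\Bigr\}\,d\lambda.$$ -/

import Mathlib

open MeasureTheory Filter Topology Set

namespace NonlocalScattering

noncomputable section

/-- The half-line Fourier transform `ṽ(l) = ∫_0^∞ e^{-i l x} v(x) dx`, for real `l`. -/
def vTilde (v : ℝ → ℂ) (l : ℝ) : ℂ :=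
  ∫ x in Ioi (0 : ℝ), Complex.exp (-(Complex.I * l * x)) * v x

/-- `W(l) = ṽ(l) - ṽ(-l)`. -/
def W (v : ℝ → ℂ) (l : ℝ) : ℂ := vTilde v l - vTilde v (-l)

/-- `g(y) = ∫_0^∞ conj (v(x + y)) v(x) dx`. -/
def g (v : ℝ → ℂ) (y : ℝ) : ℂ :=
  ∫ x in Ioi (0 : ℝ), starRingEnd ℂ (v (x + y)) * v x

/-- `Φ(l) = ∫_0^∞ e^{-i l y} g(y) dy`, for real `l`. -/
def Phi (v : ℝ → ℂ) (l : ℝ) : ℂ :=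
  ∫ y in Ioi (0 : ℝ), Complex.exp (-(Complex.I * l * y)) * g v y

/-- The function `r(l) = Φ*(l) + Φ(-l) - ṽ*(l) ṽ(-l) - 2 i l / α` for real `l`, a `1 × 1`
determinant in the rank-one case; on the real axis `f*(l) = conj (f(conj l)) = conj (f(l))`. -/
def r (α : ℝ) (v : ℝ → ℂ) (l : ℝ) : ℂ :=
  starRingEnd ℂ (Phi v l) + Phi v (-l) - starRingEnd ℂ (vTilde v l) * vTilde v (-l)
    - 2 * Complex.I * l / α

/-- `ψ(l, x) = ∫_x^∞ (sin(l (t - x)) / l) v(t) dt`, used for real `l ≠ 0`. -/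
def psi (v : ℝ → ℂ) (l x : ℝ) : ℂ :=
  ∫ t in Ioi x, ((Real.sin (l * (t - x)) / l : ℝ) : ℂ) * v t

/-- `φ(l) = ∫_0^∞ ∫_x^∞ (sin(l (t - x)) / l) v(t) dt conj (v(x)) dx`, used for real `l ≠ 0`. -/
def phi (v : ℝ → ℂ) (l : ℝ) : ℂ :=
  ∫ x in Ioi (0 : ℝ), psi v l x * starRingEnd ℂ (v x)

/-- The Jost solution `e(l, x) = e^{i l x} (α φ(l) - 1) - α ṽ*(l) ψ(l, x)`, for real `l ≠ 0`, of
`-y''(x) + α v(x) ∫_0^∞ y(t) conj (v(t)) dt = l² y(x)`. -/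
def jost (α : ℝ) (v : ℝ → ℂ) (l x : ℝ) : ℂ :=
  Complex.exp (Complex.I * l * x) * (α * phi v l - 1)
    - α * starRingEnd ℂ (vTilde v l) * psi v l x

/-- The scattering function `S(l) = e(-l, 0) / e(l, 0)`, for real `l ≠ 0`. -/
def S (α : ℝ) (v : ℝ → ℂ) (l : ℝ) : ℂ := jost α v (-l) 0 / jost α v l 0

/-- `F(l) = ṽ(-l) ṽ*(l) - Φ*(l) - Φ(-l)`, the boundary value of `2 i l ⟨R₀(l²) v, v⟩` from the upper
half-plane, where `R₀` is the resolvent of `-d²/dx²` on the half-line with `y(0) = 0`. -/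
def F (v : ℝ → ℂ) (l : ℝ) : ℂ :=
  vTilde v (-l) * starRingEnd ℂ (vTilde v l) - starRingEnd ℂ (Phi v l) - Phi v (-l)

/-- `B⁻(l) = 1 - (α / (2 i l)) F(-l)` for real `l ≠ 0`, the boundary value of
`1 + α ⟨R₀(l²) v, v⟩` from the lower half-plane. -/
def BMinus (α : ℝ) (v : ℝ → ℂ) (l : ℝ) : ℂ :=
  1 - α / (2 * Complex.I * l) * F v (-l)

/-- `ζ` is the scattering phase: the continuous real function on the line that vanishes at infinity
and satisfies `S(l) = e^{-2 i ζ(l)}`.  The formula for `S` is of the form `0 / 0` at `l = 0`, where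
`S` is understood by continuity. -/
def IsPhase (α : ℝ) (v : ℝ → ℂ) (ζ : ℝ → ℝ) : Prop :=
  Continuous ζ ∧ Tendsto ζ (cocompact ℝ) (𝓝 0) ∧
    ∀ l : ℝ, l ≠ 0 → S α v l = Complex.exp (-(2 * Complex.I * ζ l))

/-- The Cauchy principal value `p.v. ∫_ℝ f(t) / (t - x) dt` exists and equals `I`: the truncated
integrals converge absolutely and tend to `I`. -/
def HasCauchyPV (f : ℝ → ℝ) (x I : ℝ) : Prop :=
  (∀ ε : ℝ, 0 < ε → IntegrableOn (fun t => f t / (t - x)) {t | ε < |t - x|}) ∧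
    Tendsto (fun ε : ℝ => ∫ t in {t | ε < |t - x|}, f t / (t - x)) (𝓝[>] 0) (𝓝 I)

end

end NonlocalScattering

/-! Everything is read off one function, `1 + P` with `P(z) = α⟨R₀(z²)v, v⟩` (`resolventForm`), on
the closed upper half-plane. On the real axis away from `0`, `e(λ,0) = -(1 + P(λ))`, `B⁻(λ) = conj
(1 + P(λ))`, `r(λ) = -(2iλ/α)(1 + P(λ))` and `Im P(λ) = α|W(λ)|²/(4λ)`. Hence `S = conj (1 + P) / (1
+ P)`, and the phase must be the argument of `1 + P`.

The main point is a logarithm of `1 + P` that is holomorphic inside, continuous up to the axis and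
`O(1/(1+|z|))`. The function `P` is written as an absolutely convergent superposition of
exponentials `e^{iz(x+t-2s)}` with `x + t - 2s ≥ 0`. This gives holomorphy, continuity at the
boundary including `z = 0`, and positivity on the imaginary axis, where `P` is an integral of
squares. Since `Im P ≥ 0` on the positive real axis as well, Phragmén–Lindelöf gives `Im P ≥ 0` in
the first quadrant. There `1 + P` stays in the closed upper half-plane and, by the hypothesis on
`r`, never vanishes, so the principal logarithm applies; reflection `z ↦ -conj z` supplies the other
quadrant (`boundaryLog`).

With `h = log (1 + P)` and `ζ = Im h`, Cauchy's theorem gives `p.v. ∫ ζ(t)/(t-λ) dt = π Re h(λ)`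
(`hasCauchyPV_im`). The formula for `|W|²` is then the imaginary part of `e^h = 1 + P`, and the
formula for `α` is its integral, by Plancherel for the sine transform. Uniqueness of `ζ` holds
because two phases differ by a continuous function with values in `πℤ` away from `0` that tends to
`0` at infinity. -/

namespace NonlocalScattering

/-! ### Cauchy's theorem and the Hilbert transform of boundary values -/

section ContourIntegral

variable {h : ℂ → ℂ}

/-- Cauchy's theorem on the half annulus `{a ≤ ‖z‖ ≤ b, 0 ≤ Im z}`. -/
theorem integral_halfAnnulus (hc : ContinuousOn h {z | 0 ≤ z.im})
    (hd : DifferentiableOn ℂ h {z | 0 < z.im}) {a b : ℝ} (ha : 0 < a) (hab : a ≤ b) :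
    ∫ s in a..b, (h s - h (-s : ℝ)) / s =
      Complex.I * (∫ θ in (0 : ℝ)..Real.pi, h (a * Complex.exp (θ * Complex.I))) -
      Complex.I * (∫ θ in (0 : ℝ)..Real.pi, h (b * Complex.exp (θ * Complex.I))) := by
  have hb : 0 < b := ha.trans_le hab
  have him : ∀ w : ℂ, (Complex.exp w).im = Real.exp w.re * Real.sin w.im := Complex.exp_im
  -- The exponential maps the rectangle `[log a, log b] × [0, π]` onto the half annulus and turns
  -- `dz / z` into `dw`, so the rectangular Cauchy theorem suffices.
  have key := Complex.integral_boundary_rect_eq_zero_of_continuousOn_of_differentiableOn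
    (fun w => h (Complex.exp w)) (Real.log a : ℂ) (Real.log b + Real.pi * Complex.I) ?_ ?_
  · have hlog : Real.log a ≤ Real.log b := Real.log_le_log ha hab
    have cv : ∀ k : ℝ → ℂ, ContinuousOn k (Ioi 0) →
        ∫ x in Real.log a..Real.log b, k (Real.exp x) = ∫ s in a..b, k s / s := by
      intro k hk
      have := intervalIntegral.integral_deriv_smul_comp'' (a := Real.log a) (b := Real.log b)
        (f := Real.exp) (f' := Real.exp) (g := fun s => k s / s) Real.continuous_exp.continuousOn
        (fun x _ => (Real.hasDerivAt_exp x).hasDerivWithinAt) Real.continuous_exp.continuousOn ?_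
      · rw [Real.exp_log ha, Real.exp_log hb] at this
        rw [← this]
        refine intervalIntegral.integral_congr fun x _ => ?_
        have : (Real.exp x : ℂ) ≠ 0 := by exact_mod_cast (Real.exp_pos x).ne'
        simp only [Function.comp, Complex.real_smul]
        field_simp
      · refine ContinuousOn.div (hk.mono ?_) Complex.continuous_ofReal.continuousOn ?_
        · rintro _ ⟨x, _, rfl⟩
          exact Real.exp_pos x
        · rintro _ ⟨x, _, rfl⟩
          exact_mod_cast (Real.exp_pos x).ne'
    have c1 : ContinuousOn (fun s : ℝ => h s) (Ioi 0) :=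
      hc.comp Complex.continuous_ofReal.continuousOn (fun x _ => by simp)
    have c2 : ContinuousOn (fun s : ℝ => h (-s : ℝ)) (Ioi 0) :=
      hc.comp (Complex.continuous_ofReal.comp continuous_neg).continuousOn (fun x _ => by simp)
    have hr : ∀ a : ℝ, 0 < a → ∀ θ : ℝ, Complex.exp (Real.log a + θ * Complex.I) =
        a * Complex.exp (θ * Complex.I) := by
      intro a ha θ
      rw [Complex.exp_add, ← Complex.ofReal_exp, Real.exp_log ha]
    have e1 := cv _ c1
    have e2 := cv _ c2
    have i1 : IntervalIntegrable (fun s : ℝ => h s / s) volume a b := by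
      refine ContinuousOn.intervalIntegrable (ContinuousOn.div (c1.mono ?_)
        Complex.continuous_ofReal.continuousOn ?_)
      · intro x hx; rw [uIcc_of_le hab] at hx; exact ha.trans_le hx.1
      · intro x hx; rw [uIcc_of_le hab] at hx; exact_mod_cast (ha.trans_le hx.1).ne'
    have i2 : IntervalIntegrable (fun s : ℝ => h (-s : ℝ) / s) volume a b := by
      refine ContinuousOn.intervalIntegrable (ContinuousOn.div (c2.mono ?_)
        Complex.continuous_ofReal.continuousOn ?_)
      · intro x hx; rw [uIcc_of_le hab] at hx; exact ha.trans_le hx.1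
      · intro x hx; rw [uIcc_of_le hab] at hx; exact_mod_cast (ha.trans_le hx.1).ne'
    simp only [Complex.ofReal_re, Complex.ofReal_im, Complex.add_re, Complex.add_im,
      Complex.mul_re, Complex.mul_im, Complex.I_re, Complex.I_im, mul_zero, mul_one,
      zero_mul, add_zero, zero_add, sub_self, Complex.ofReal_zero, smul_eq_mul, hr a ha, hr b hb]
      at key
    simp only [sub_div]
    rw [intervalIntegral.integral_sub i1 i2, ← e1, ← e2]
    have e3 : ∀ x : ℝ, Complex.exp (x + Real.pi * Complex.I) = ((-Real.exp x : ℝ) : ℂ) := by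
      intro x
      rw [Complex.exp_add, Complex.exp_pi_mul_I]
      push_cast; ring
    simp only [e3, ← Complex.ofReal_exp] at key
    linear_combination key
  · refine hc.comp Complex.continuous_exp.continuousOn ?_
    intro w hw
    have hw := hw.2
    simp only [mem_preimage, Complex.ofReal_im, Complex.add_im, Complex.mul_im, Complex.ofReal_re,
      Complex.I_im, Complex.I_re, mul_one, mul_zero, add_zero, zero_add] at hw
    rw [uIcc_of_le Real.pi_pos.le] at hw
    simp only [mem_ofPred_eq, him]
    exact mul_nonneg (Real.exp_pos _).le (Real.sin_nonneg_of_mem_Icc hw)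
  · refine hd.comp Complex.differentiable_exp.differentiableOn ?_
    intro w hw
    have hw := hw.2
    simp only [mem_preimage, Complex.ofReal_im, Complex.add_im, Complex.mul_im, Complex.ofReal_re,
      Complex.I_im, Complex.I_re, mul_one, mul_zero, add_zero, zero_add,
      min_eq_left Real.pi_pos.le, max_eq_right Real.pi_pos.le] at hw
    simp only [mem_ofPred_eq, him]
    exact mul_pos (Real.exp_pos _) (Real.sin_pos_of_mem_Ioo hw)

theorem norm_mul_exp_I {a : ℝ} (ha : 0 ≤ a) (θ : ℝ) :
    ‖(a : ℂ) * Complex.exp (θ * Complex.I)‖ = a := by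
  rw [norm_mul, Complex.norm_exp_ofReal_mul_I, mul_one, Complex.norm_real, Real.norm_of_nonneg ha]

theorem im_mul_exp_I_nonneg {a θ : ℝ} (ha : 0 ≤ a) (hθ : θ ∈ Icc 0 Real.pi) :
    0 ≤ ((a : ℂ) * Complex.exp (θ * Complex.I)).im := by
  rw [Complex.im_ofReal_mul, Complex.exp_ofReal_mul_I_im]
  exact mul_nonneg ha (Real.sin_nonneg_of_mem_Icc hθ)

theorem continuous_ofReal_of_upper (hc : ContinuousOn h {z | 0 ≤ z.im}) :
    Continuous fun s : ℝ => h s :=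
  hc.comp_continuous Complex.continuous_ofReal (fun x => by simp)

theorem measurableSet_truncation (ε l : ℝ) : MeasurableSet {t : ℝ | ε < |t - l|} :=
  measurableSet_lt measurable_const (by fun_prop)

theorem integrableOn_div_of_decay (hc : ContinuousOn h {z | 0 ≤ z.im}) {C : ℝ}
    (hb : ∀ z : ℂ, 0 ≤ z.im → ‖h z‖ ≤ C / (1 + ‖z‖)) {ε : ℝ} (hε : 0 < ε) :
    IntegrableOn (fun s : ℝ => h s / s) {s | ε < |s|} := by
  have hms : MeasurableSet {s : ℝ | ε < |s|} := by simpa using measurableSet_truncation ε 0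
  have hC : 0 ≤ C := by
    have := (norm_nonneg _).trans (hb 0 (by simp))
    simpa using this
  -- For `|s| > ε`, `1 ≤ |s| / ε` gives `1 + s² ≤ (1 + 1/ε)(1 + |s|)|s|`, whence this majorant.
  refine Integrable.mono' (g := fun s : ℝ => C * (1 + 1 / ε) * (1 + s ^ 2)⁻¹)
    ((integrable_inv_one_add_sq.const_mul _).integrableOn) ?_ ?_
  · exact ((continuous_ofReal_of_upper hc).measurable.div
      Complex.measurable_ofReal).aestronglyMeasurable
  · filter_upwards [ae_restrict_mem hms] with s hs
    have hs : ε < |s| := hs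
    have h1 := hb s (by simp)
    rw [Complex.norm_real, Real.norm_eq_abs] at h1
    rw [norm_div, Complex.norm_real, Real.norm_eq_abs]
    have hs0 : 0 < |s| := hε.trans hs
    calc ‖h s‖ / |s| ≤ C / (1 + |s|) / |s| := by gcongr
      _ ≤ C * (1 + 1 / ε) * (1 + s ^ 2)⁻¹ := by
        rw [div_div, mul_assoc, div_eq_mul_inv]
        gcongr
        rw [inv_le_iff_one_le_mul₀ (by positivity), mul_comm, ← mul_assoc]
        rw [← div_eq_mul_inv, le_div_iff₀ (by positivity), ← sq_abs s]
        have : 1 ≤ |s| * (1 / ε) := by rw [mul_one_div, le_div_iff₀ hε]; linarith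
        nlinarith [mul_nonneg (abs_nonneg s) (abs_nonneg s)]

/-- Folding the two half-lines onto `(ε, ∞)` produces the straight sides of a half annulus; the
outer semicircle contributes at most `πC/(1+R)` and disappears as `R → ∞`. -/
theorem integral_truncation_eq (hc : ContinuousOn h {z | 0 ≤ z.im})
    (hd : DifferentiableOn ℂ h {z | 0 < z.im}) {C : ℝ}
    (hb : ∀ z : ℂ, 0 ≤ z.im → ‖h z‖ ≤ C / (1 + ‖z‖)) {ε : ℝ} (hε : 0 < ε) :
    ∫ s in {s : ℝ | ε < |s|}, h s / s =
      Complex.I * ∫ θ in (0 : ℝ)..Real.pi, h (ε * Complex.exp (θ * Complex.I)) := by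
  have hint := integrableOn_div_of_decay hc hb hε
  have hset : {s : ℝ | ε < |s|} = Iio (-ε) ∪ Ioi ε := by
    ext s
    simp only [mem_ofPred_eq, lt_abs, mem_union, mem_Iio, mem_Ioi]
    constructor <;> rintro (h | h) <;> [right; left; right; left] <;> linarith
  rw [hset] at hint ⊢
  have h1 := hint.mono_set subset_union_left
  have h2 := hint.mono_set subset_union_right
  have h3 : IntegrableOn (fun s : ℝ => h (-s : ℝ) / (-s : ℝ)) (Ioi ε) := by
    have := IntegrableOn.comp_neg h1
    simpa using this
  have hsum : IntegrableOn (fun s : ℝ => (h s - h (-s : ℝ)) / s) (Ioi ε) := by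
    refine (h2.add h3).congr_fun (fun s _ => ?_) measurableSet_Ioi
    simp only [Pi.add_apply]
    push_cast
    rw [div_neg, sub_div, sub_eq_add_neg]
  have hlim := intervalIntegral_tendsto_integral_Ioi ε hsum (tendsto_id (α := ℝ))
  have hlim2 : Tendsto (fun R : ℝ => ∫ s in ε..R, (h s - h (-s : ℝ)) / s) atTop
      (𝓝 (Complex.I * (∫ θ in (0 : ℝ)..Real.pi, h (ε * Complex.exp (θ * Complex.I))) -
        Complex.I * 0)) := by
    have hz : Tendsto (fun R : ℝ => ∫ θ in (0 : ℝ)..Real.pi, h (R * Complex.exp (θ * Complex.I)))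
        atTop (𝓝 0) := by
      have hdec : Tendsto (fun R : ℝ => C / (1 + R) * |Real.pi - 0|) atTop (𝓝 0) := by
        have := (tendsto_const_nhds.div_atTop (tendsto_atTop_add_const_left _ _ tendsto_id) :
          Tendsto (fun R : ℝ => C / (1 + R)) atTop (𝓝 0)).mul_const |Real.pi - 0|
        rwa [zero_mul] at this
      refine squeeze_zero_norm' ?_ hdec
      filter_upwards [eventually_ge_atTop (0 : ℝ)] with R hR
      refine intervalIntegral.norm_integral_le_of_norm_le_const fun θ hθ => ?_
      rw [uIoc_of_le Real.pi_pos.le] at hθ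
      have := hb _ (im_mul_exp_I_nonneg hR ⟨hθ.1.le, hθ.2⟩)
      rwa [norm_mul_exp_I hR] at this
    refine (tendsto_const_nhds.sub (hz.const_mul _)).congr' ?_
    filter_upwards [eventually_ge_atTop ε] with R hR
    exact (integral_halfAnnulus hc hd hε hR).symm
  have heq := tendsto_nhds_unique hlim hlim2
  rw [mul_zero, sub_zero] at heq
  rw [← heq, setIntegral_union _ measurableSet_Ioi h1 h2, ← integral_Iic_eq_integral_Iio,
    ← integral_comp_neg_Ioi, add_comm, ← integral_add h2 h3]
  · refine setIntegral_congr_fun measurableSet_Ioi fun s _ => ?_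
    push_cast
    rw [div_neg, sub_div, sub_eq_add_neg]
  · exact disjoint_left.2 fun s hs hs' => by
      simp only [mem_Iio, mem_Ioi] at hs hs'
      linarith

/-- This is the half residue at a simple pole on the contour: on the small semicircle `h` tends to
`h 0` and is dominated by `C`. -/
theorem tendsto_integral_truncation (hc : ContinuousOn h {z | 0 ≤ z.im})
    (hd : DifferentiableOn ℂ h {z | 0 < z.im}) {C : ℝ}
    (hb : ∀ z : ℂ, 0 ≤ z.im → ‖h z‖ ≤ C / (1 + ‖z‖)) :
    Tendsto (fun ε : ℝ => ∫ s in {s : ℝ | ε < |s|}, h s / s) (𝓝[>] 0)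
      (𝓝 (Complex.I * (Real.pi * h 0))) := by
  have hC : 0 ≤ C := by
    have := (norm_nonneg _).trans (hb 0 (by simp))
    simpa using this
  have hlim : Tendsto
      (fun ε : ℝ => ∫ θ in (0 : ℝ)..Real.pi, h (ε * Complex.exp (θ * Complex.I))) (𝓝[>] 0)
      (𝓝 (∫ _ in (0 : ℝ)..Real.pi, h 0)) := by
    refine intervalIntegral.tendsto_integral_filter_of_dominated_convergence (fun _ => C) ?_ ?_
      intervalIntegrable_const ?_
    · filter_upwards [self_mem_nhdsWithin] with ε hε
      refine ContinuousOn.aestronglyMeasurable ?_ measurableSet_uIoc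
      refine hc.comp (Continuous.continuousOn (by fun_prop)) fun θ hθ => ?_
      rw [uIoc_of_le Real.pi_pos.le] at hθ
      exact im_mul_exp_I_nonneg (le_of_lt hε) ⟨hθ.1.le, hθ.2⟩
    · filter_upwards [self_mem_nhdsWithin] with ε hε
      refine ae_of_all _ fun θ hθ => ?_
      rw [uIoc_of_le Real.pi_pos.le] at hθ
      exact (hb _ (im_mul_exp_I_nonneg (le_of_lt hε) ⟨hθ.1.le, hθ.2⟩)).trans
        (div_le_self hC (by linarith [norm_nonneg ((ε : ℂ) * Complex.exp (θ * Complex.I))]))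
    · refine ae_of_all _ fun θ hθ => ?_
      rw [uIoc_of_le Real.pi_pos.le] at hθ
      have h0 : ContinuousWithinAt h {z | 0 ≤ z.im} 0 := hc 0 (by simp)
      refine h0.tendsto.comp (tendsto_nhdsWithin_iff.2 ⟨?_, ?_⟩)
      · have : Continuous fun ε : ℝ => (ε : ℂ) * Complex.exp (θ * Complex.I) := by fun_prop
        have := this.tendsto 0
        rw [Complex.ofReal_zero, zero_mul] at this
        exact this.mono_left nhdsWithin_le_nhds
      · filter_upwards [self_mem_nhdsWithin] with ε hε
        exact im_mul_exp_I_nonneg (le_of_lt hε) ⟨hθ.1.le, hθ.2⟩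
  rw [intervalIntegral.integral_const, sub_zero, Complex.real_smul] at hlim
  refine (hlim.const_mul Complex.I).congr' ?_
  filter_upwards [self_mem_nhdsWithin] with ε hε
  exact (integral_truncation_eq hc hd hb hε).symm

/-- The Hilbert transform relation between the real and the imaginary part on the real line of a
function holomorphic in the upper half-plane, continuous up to the boundary and decaying. -/
theorem hasCauchyPV_im (hc : ContinuousOn h {z | 0 ≤ z.im})
    (hd : DifferentiableOn ℂ h {z | 0 < z.im}) {C : ℝ}
    (hb : ∀ z : ℂ, 0 ≤ z.im → ‖h z‖ ≤ C / (1 + ‖z‖)) (l : ℝ) :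
    HasCauchyPV (fun t => (h t).im) l (Real.pi * (h l).re) := by
  have hC : 0 ≤ C := by
    have := (norm_nonneg _).trans (hb 0 (by simp))
    simpa using this
  -- A real translation moves the pole to the origin and preserves the upper half-plane; the decay
  -- constant grows to `C(1 + |l|)`.
  set k : ℂ → ℂ := fun z => h (l + z) with hk
  have kc : ContinuousOn k {z | 0 ≤ z.im} :=
    hc.comp (by fun_prop) (fun z hz => by simpa using hz)
  have kd : DifferentiableOn ℂ k {z | 0 < z.im} :=
    hd.comp (by fun_prop) (fun z hz => by simpa using hz)
  have kb : ∀ z : ℂ, 0 ≤ z.im → ‖k z‖ ≤ C * (1 + |l|) / (1 + ‖z‖) := by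
    intro z hz
    refine (hb (l + z) (by simpa using hz)).trans ?_
    have h1 : ‖z‖ ≤ |l| + ‖(l : ℂ) + z‖ := by
      have := norm_sub_le ((l : ℂ) + z) l
      rw [add_sub_cancel_left, Complex.norm_real, Real.norm_eq_abs] at this
      linarith
    rw [div_le_div_iff₀ (by positivity) (by positivity), mul_assoc]
    gcongr
    nlinarith [mul_nonneg (abs_nonneg l) (norm_nonneg ((l : ℂ) + z))]
  have htrans : ∀ ε : ℝ, ∀ t : ℝ,
      {t : ℝ | ε < |t - l|}.indicator (fun t : ℝ => h t / (t - l : ℝ)) (l + t) =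
      {s : ℝ | ε < |s|}.indicator (fun s : ℝ => k s / s) t := by
    intro ε t
    simp only [indicator, mem_ofPred_eq, add_sub_cancel_left, hk]
    push_cast
    simp
  have hms : ∀ ε : ℝ, MeasurableSet {s : ℝ | ε < |s|} := fun ε => by
    simpa using measurableSet_truncation ε 0
  have hI : ∀ ε : ℝ, 0 < ε →
      IntegrableOn (fun t : ℝ => h t / (t - l : ℝ)) {t : ℝ | ε < |t - l|} := by
    intro ε hε
    have := integrableOn_div_of_decay kc kb hε
    rw [← integrable_indicator_iff (hms ε)] at this
    rw [← integrable_indicator_iff (measurableSet_truncation ε l)]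
    rw [← (measurePreserving_add_left volume l).integrable_comp_emb
      (Homeomorph.addLeft l).measurableEmbedding]
    exact this.congr (ae_of_all _ fun t => (htrans ε t).symm)
  have hV : ∀ ε : ℝ, ∫ t in {t : ℝ | ε < |t - l|}, h t / (t - l : ℝ) =
      ∫ s in {s : ℝ | ε < |s|}, k s / s := by
    intro ε
    rw [← integral_indicator (measurableSet_truncation ε l), ← integral_indicator (hms ε),
      ← integral_add_left_eq_self _ l]
    exact integral_congr_ae (ae_of_all _ (htrans ε))
  have him : ∀ t : ℝ, RCLike.im (h t / (t - l : ℝ)) = (h t).im / (t - l) := fun t => by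
    change (h t / (t - l : ℝ)).im = _
    rw [Complex.div_ofReal_im]
  constructor
  · intro ε hε
    exact (hI ε hε).im.congr (ae_of_all _ him)
  · have hlim := tendsto_integral_truncation kc kd kb
    have := (Complex.continuous_im.tendsto _).comp hlim
    have e : (Complex.I * (Real.pi * k 0)).im = Real.pi * (h l).re := by
      simp [hk]
    rw [e] at this
    refine this.congr' ?_
    filter_upwards [self_mem_nhdsWithin] with ε hε
    simp only [Function.comp]
    rw [← hV ε]
    refine (integral_im (𝕜 := ℂ) (hI ε hε)).symm.trans ?_
    exact integral_congr_ae (ae_of_all _ him)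

end ContourIntegral

/-! ### A logarithm of `1 + P` continuous up to the real axis -/

section BoundaryLog

open Complex ComplexConjugate

/-- The argument lies in `(-π, π]`, so the principal logarithm is continuous from above at the cut.
This is needed because `1 + P` may be negative at real points. -/
theorem continuousWithinAt_log_upper {w : ℂ} (hw : w ≠ 0) :
    ContinuousWithinAt log {z | 0 ≤ z.im} w := by
  by_cases h : w ∈ slitPlane
  · exact (continuousAt_clog h).continuousWithinAt
  · rw [mem_slitPlane_iff, not_or, not_lt, not_not] at h
    refine continuousWithinAt_log_of_re_neg_of_im_zero (lt_of_le_of_ne h.1 fun h0 => hw ?_) h.2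
    exact Complex.ext h0 h.2

/-- A function `P` on the closed upper half-plane with the symmetry, positivity and decay of
`z ↦ α ⟨R₀(z²) v, v⟩`, such that `1 + P` has no real zeros. -/
structure IsResolventLike (P : ℂ → ℂ) : Prop where
  continuousOn : ContinuousOn P {z | 0 ≤ z.im}
  differentiableOn : DifferentiableOn ℂ P {z | 0 < z.im}
  bound : ∃ C : ℝ, ∀ z : ℂ, 0 ≤ z.im → ‖P z‖ ≤ C / (1 + ‖z‖)
  symm : ∀ z : ℂ, 0 ≤ z.im → P (-conj z) = conj (P z)
  imag_re : ∀ y : ℝ, 0 ≤ y → 0 ≤ (P (y * I)).re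
  real_im : ∀ x : ℝ, 0 < x → 0 ≤ (P x).im
  ne_zero : ∀ x : ℝ, x ≠ 0 → 1 + P x ≠ 0

namespace IsResolventLike

variable {P : ℂ → ℂ} (hP : IsResolventLike P)
include hP

theorem imag_im {y : ℝ} (hy : 0 ≤ y) : (P (y * I)).im = 0 := by
  have := hP.symm (y * I) (by simpa using hy)
  have e : -conj ((y : ℂ) * I) = y * I := by simp
  rw [e] at this
  exact conj_eq_iff_im.1 this.symm

theorem real_im_nonneg {x : ℝ} (hx : 0 ≤ x) : 0 ≤ (P x).im := by
  rcases hx.eq_or_lt with rfl | hx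
  · have := hP.imag_im le_rfl
    simp only [ofReal_zero, zero_mul] at this ⊢
    exact this.ge
  · exact hP.real_im x hx

/-- The sign of `Im P` is known on both edges of the first quadrant. Phragmén–Lindelöf for `exp
(iP)`, whose modulus is `e^{-Im P}`, carries it inside; `P` is bounded, so the growth condition
holds with exponent `0`. -/
theorem im_nonneg {z : ℂ} (hre : 0 ≤ z.re) (him : 0 ≤ z.im) : 0 ≤ (P z).im := by
  have hn : ∀ w, ‖exp (I * P w)‖ = Real.exp (-(P w).im) := fun w => by simp [norm_exp]
  have hsub : Ioi 0 ×ℂ Ioi 0 ⊆ {z : ℂ | 0 < z.im} := fun w hw => hw.2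
  have hcl : closure (Ioi 0 ×ℂ Ioi 0) ⊆ {z : ℂ | 0 ≤ z.im} := by
    rw [closure_reProdIm, closure_Ioi]
    exact fun w hw => hw.2
  obtain ⟨C, hC⟩ := hP.bound
  have hC0 : 0 ≤ C := by
    have := (norm_nonneg _).trans (hC 0 (by simp))
    simpa using this
  have := PhragmenLindelof.quadrant_I (f := fun z => exp (I * P z)) (C := 1)
    ⟨((hP.differentiableOn.mono hsub).const_mul I).cexp,
      (continuousOn_const.mul (hP.continuousOn.mono hcl)).cexp⟩
    ⟨0, two_pos, 0, ?_⟩ ?_ ?_ hre him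
  · rw [hn, Real.exp_le_one_iff] at this
    linarith
  · refine Asymptotics.IsBigO.of_bound (Real.exp C) ?_
    refine Filter.eventually_inf_principal.2 (Eventually.of_forall fun w hw => ?_)
    rw [hn]
    simp only [zero_mul, Real.exp_zero, norm_one, mul_one]
    refine Real.exp_le_exp.2 ?_
    have h1 := hC w (le_of_lt hw.2)
    have h2 := neg_le_abs (P w).im
    have h3 := abs_im_le_norm (P w)
    have h4 : C / (1 + ‖w‖) ≤ C := div_le_self hC0 (by linarith [norm_nonneg w])
    linarith
  · intro x hx
    rw [hn, Real.exp_le_one_iff]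
    linarith [hP.real_im_nonneg hx]
  · intro y hy
    rw [hn, hP.imag_im hy]
    simp

/-- A non-constant `P` would be open on the quadrant and so take values just below `P z`, against
`Im P ≥ 0`. A constant `P` must be `0`, as decay along the ray through `z` shows. -/
theorem eq_zero_of_im_eq_zero {z : ℂ} (hre : 0 < z.re) (him : 0 < z.im) (h0 : (P z).im = 0) :
    P z = 0 := by
  have hopen : IsOpen (Ioi (0 : ℝ) ×ℂ Ioi (0 : ℝ)) := isOpen_Ioi.reProdIm isOpen_Ioi
  have hsub : Ioi 0 ×ℂ Ioi 0 ⊆ {z : ℂ | 0 < z.im} := fun w hw => hw.2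
  have hz : z ∈ Ioi (0 : ℝ) ×ℂ Ioi (0 : ℝ) := ⟨hre, him⟩
  have hconv : Convex ℝ (Ioi (0 : ℝ) ×ℂ Ioi (0 : ℝ)) :=
    ((convex_Ioi 0).linear_preimage reLm).inter ((convex_Ioi 0).linear_preimage imLm)
  rcases ((hP.differentiableOn.mono hsub).analyticOnNhd hopen).is_constant_or_isOpen
    hconv.isPreconnected with ⟨w, hw⟩ | hop
  · obtain ⟨C, hC⟩ := hP.bound
    have hlim : Tendsto (fun n : ℕ => C / (1 + ‖((n : ℝ) + 1 : ℂ) * z‖)) atTop (𝓝 0) := by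
      refine tendsto_const_nhds.div_atTop (tendsto_atTop_add_const_left _ _ ?_)
      have : ∀ n : ℕ, ‖((n : ℝ) + 1 : ℂ) * z‖ = ((n : ℝ) + 1) * ‖z‖ := fun n => by
        rw [norm_mul]
        congr 1
        have : ((n : ℝ) + 1 : ℂ) = (((n : ℝ) + 1 : ℝ) : ℂ) := by push_cast; rfl
        rw [this, norm_real, Real.norm_of_nonneg (by positivity)]
      simp only [this]
      have hz0 : 0 < ‖z‖ := norm_pos_iff.2 fun h => by simp [h] at hre
      exact (tendsto_atTop_add_const_right _ _ tendsto_natCast_atTop_atTop).atTop_mul_const hz0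
    have hle : ∀ n : ℕ, ‖P z‖ ≤ C / (1 + ‖((n : ℝ) + 1 : ℂ) * z‖) := by
      intro n
      have hm : ((n : ℝ) + 1 : ℂ) * z ∈ Ioi (0 : ℝ) ×ℂ Ioi (0 : ℝ) := by
        have : ((n : ℝ) + 1 : ℂ) = (((n : ℝ) + 1 : ℝ) : ℂ) := by push_cast; rfl
        rw [this]
        refine ⟨?_, ?_⟩
        · simp only [mem_preimage, re_ofReal_mul, mem_Ioi]; positivity
        · simp only [mem_preimage, im_ofReal_mul, mem_Ioi]; positivity
      rw [hw z hz, ← hw _ hm]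
      exact hC _ (le_of_lt hm.2)
    exact norm_le_zero_iff.1 (ge_of_tendsto' hlim hle)
  · exfalso
    have hO := hop _ subset_rfl hopen
    obtain ⟨δ, hδ, hball⟩ := Metric.isOpen_iff.1 hO (P z) ⟨z, hz, rfl⟩
    have hm : P z - (δ / 2 : ℝ) * I ∈ Metric.ball (P z) δ := by
      rw [Metric.mem_ball, dist_eq_norm, sub_sub_cancel_left, norm_neg, norm_mul, norm_I, mul_one,
        norm_real, Real.norm_of_nonneg (by positivity)]
      linarith
    obtain ⟨w, hw, hwe⟩ := hball hm
    have h1 := hP.im_nonneg (le_of_lt hw.1) (le_of_lt hw.2)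
    rw [hwe, sub_im, h0, im_ofReal_mul, I_im] at h1
    linarith

theorem slitPlane_of_imag {y : ℝ} (hy : 0 ≤ y) : 1 + P (y * I) ∈ slitPlane := by
  refine mem_slitPlane_iff.2 (Or.inl ?_)
  rw [add_re, one_re]
  linarith [hP.imag_re y hy]

theorem slitPlane_of_re_nonneg {z : ℂ} (hre : 0 ≤ z.re) (him : 0 < z.im) :
    1 + P z ∈ slitPlane := by
  rcases hre.eq_or_lt with h0 | hre
  · have : z = z.im * I := by
      apply Complex.ext <;> simp [← h0]
    rw [this]
    exact hP.slitPlane_of_imag him.le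
  · by_cases h : (P z).im = 0
    · rw [hP.eq_zero_of_im_eq_zero hre him h, add_zero]
      exact one_mem_slitPlane
    · refine mem_slitPlane_iff.2 (Or.inr ?_)
      rwa [add_im, one_im, zero_add]

/-- The field `ne_zero` says nothing at the origin; there positivity on the imaginary axis gives `Re
(1 + P 0) ≥ 1`. -/
theorem ne_zero_of_re_nonneg {z : ℂ} (hre : 0 ≤ z.re) (him : 0 ≤ z.im) : 1 + P z ≠ 0 := by
  rcases him.eq_or_lt with h0 | him
  · have : z = z.re := by apply Complex.ext <;> simp [← h0]
    by_cases hx : z.re = 0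
    · have := slitPlane_ne_zero (hP.slitPlane_of_imag le_rfl)
      rw [show z = 0 from Complex.ext hx h0.symm]
      simpa using this
    · rw [this]
      exact hP.ne_zero _ hx
  · exact slitPlane_ne_zero (hP.slitPlane_of_re_nonneg hre him)

omit hP in
/-- The logarithm of `1 + P` on the closed upper half-plane. -/
noncomputable def boundaryLog (P : ℂ → ℂ) (z : ℂ) : ℂ :=
  if 0 ≤ z.re then log (1 + P z) else conj (log (1 + P (-conj z)))

theorem boundaryLog_of_re_nonpos {z : ℂ} (hre : z.re ≤ 0) (him : 0 ≤ z.im) :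
    boundaryLog P z = conj (log (1 + P (-conj z))) := by
  rw [boundaryLog]
  split_ifs with h
  · have hz : z = z.im * I := by
      apply Complex.ext <;> simp [le_antisymm hre h]
    have e : -conj ((z.im : ℂ) * I) = z.im * I := by simp
    rw [hz, e, ← log_conj _ (slitPlane_arg_ne_pi (hP.slitPlane_of_imag him))]
    congr 1
    rw [map_add, map_one, conj_eq_iff_im.2 (hP.imag_im him)]
  · rfl

theorem exp_boundaryLog {z : ℂ} (him : 0 ≤ z.im) : exp (boundaryLog P z) = 1 + P z := by
  rw [boundaryLog]
  split_ifs with h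
  · exact exp_log (hP.ne_zero_of_re_nonneg h him)
  · have h1 := hP.ne_zero_of_re_nonneg (z := -conj z) (by simp; linarith) (by simpa using him)
    rw [exp_conj, exp_log h1, hP.symm z him]
    simp

theorem continuousOn_log_quadrant :
    ContinuousOn (fun z => log (1 + P z)) {z : ℂ | 0 ≤ z.re ∧ 0 ≤ z.im} := by
  intro z hz
  have h1 : ContinuousWithinAt (fun z => 1 + P z) {z : ℂ | 0 ≤ z.re ∧ 0 ≤ z.im} z :=
    continuousWithinAt_const.add ((hP.continuousOn z hz.2).mono fun w hw => hw.2)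
  refine (continuousWithinAt_log_upper (hP.ne_zero_of_re_nonneg hz.1 hz.2)).comp
    (f := fun z => 1 + P z) h1 fun w hw => ?_
  simpa using hP.im_nonneg hw.1 hw.2

/-- In the second quadrant `1 + P` may reach the cut from below, where the principal logarithm
jumps; the reflected branch has the correct limit. The two branches agree on the imaginary axis, so
two closed quadrants can be glued. -/
theorem continuousOn_boundaryLog : ContinuousOn (boundaryLog P) {z | 0 ≤ z.im} := by
  have h1 : ContinuousOn (boundaryLog P) {z : ℂ | 0 ≤ z.re ∧ 0 ≤ z.im} :=
    hP.continuousOn_log_quadrant.congr fun z hz => if_pos hz.1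
  have h2 : ContinuousOn (boundaryLog P) {z : ℂ | z.re ≤ 0 ∧ 0 ≤ z.im} := by
    refine ContinuousOn.congr (f := fun z => conj (log (1 + P (-conj z)))) ?_
      fun z hz => hP.boundaryLog_of_re_nonpos hz.1 hz.2
    refine continuous_conj.comp_continuousOn
      (hP.continuousOn_log_quadrant.comp (f := fun z => -conj z)
        continuous_conj.neg.continuousOn ?_)
    intro z hz
    simpa using hz
  refine (h1.union_of_isClosed h2 ?_ ?_).mono fun z hz => ?_
  · exact (isClosed_le continuous_const continuous_re).inter
      (isClosed_le continuous_const continuous_im)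
  · exact (isClosed_le continuous_re continuous_const).inter
      (isClosed_le continuous_const continuous_im)
  · rcases le_total 0 z.re with h | h
    · exact Or.inl ⟨h, hz⟩
    · exact Or.inr ⟨h, hz⟩

theorem slitPlane_of_im_pos {z : ℂ} (him : 0 < z.im) : 1 + P z ∈ slitPlane := by
  rcases le_total 0 z.re with h | h
  · exact hP.slitPlane_of_re_nonneg h him
  · have h1 := hP.slitPlane_of_re_nonneg (z := -conj z) (by simpa using h) (by simpa using him)
    rw [hP.symm z him.le, mem_slitPlane_iff] at h1
    rw [mem_slitPlane_iff]
    simpa using h1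

/-- In the open half-plane `1 + P` avoids the cut, so both branches are the principal logarithm; the
reflection matters only on the boundary. -/
theorem differentiableOn_boundaryLog : DifferentiableOn ℂ (boundaryLog P) {z | 0 < z.im} := by
  refine DifferentiableOn.congr (f := fun z => log (1 + P z)) ?_ fun z hz => ?_
  · exact (hP.differentiableOn.const_add 1).clog fun z hz => hP.slitPlane_of_im_pos hz
  · rw [boundaryLog]
    split_ifs with h
    · rfl
    · rw [hP.symm z (le_of_lt hz),
        ← log_conj _ (slitPlane_arg_ne_pi ?_)]
      · simp
      · rw [← hP.symm z (le_of_lt hz)]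
        exact hP.slitPlane_of_im_pos (by simpa using hz)

/-- Outside the disc of radius `2C` one has `‖P‖ ≤ 1/2`, hence `‖log (1 + P)‖ ≤ (3/2)‖P‖`. The
remaining half disc is compact. -/
theorem norm_boundaryLog_bound :
    ∃ C : ℝ, ∀ z : ℂ, 0 ≤ z.im → ‖boundaryLog P z‖ ≤ C / (1 + ‖z‖) := by
  obtain ⟨C, hC⟩ := hP.bound
  have hC0 : 0 ≤ C := by
    have := (norm_nonneg _).trans (hC 0 (by simp))
    simpa using this
  obtain ⟨M, hM⟩ := ((isCompact_closedBall (0 : ℂ) (2 * C)).inter_left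
    (isClosed_le continuous_const continuous_im)).exists_bound_of_continuousOn
    (hP.continuousOn_boundaryLog.mono (inter_subset_left (t := Metric.closedBall (0 : ℂ) (2 * C))))
  have hlarge : ∀ z : ℂ, 0 ≤ z.im → 2 * C ≤ ‖z‖ → ‖log (1 + P z)‖ ≤ 3 / 2 * (C / (1 + ‖z‖)) := by
    intro z hz hzC
    have h1 := hC z hz
    have h2 : C / (1 + ‖z‖) ≤ 1 / 2 := by
      rw [div_le_div_iff₀ (by positivity) two_pos]; linarith
    exact (norm_log_one_add_half_le_self (h1.trans h2)).trans (by gcongr)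
  refine ⟨max (3 / 2 * C) (M * (1 + 2 * C)), fun z hz => ?_⟩
  rw [le_div_iff₀ (by positivity)]
  rcases le_total ‖z‖ (2 * C) with h | h
  · refine le_max_of_le_right ?_
    have := hM z ⟨hz, by simpa using h⟩
    have hM0 := (norm_nonneg _).trans this
    gcongr
  · refine le_max_of_le_left ?_
    rw [← le_div_iff₀ (by positivity), mul_div_assoc]
    rw [boundaryLog]
    split_ifs with hre
    · exact hlarge z hz h
    · rw [RCLike.norm_conj]
      have := hlarge (-conj z) (by simpa using hz) (by simpa using h)
      simpa using this

end IsResolventLike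

end BoundaryLog

/-! ### Superpositions of exponentials with nonnegative frequencies -/

section ExpIntegral

open Complex

variable {Ω : Type*} [MeasurableSpace Ω] {μ : Measure Ω} {f : Ω → ℂ} {c : Ω → ℝ}

theorem norm_exp_I_mul_mul_le {z w : ℂ} {c : ℝ} (hz : 0 ≤ z.im) (hc : w ≠ 0 → 0 ≤ c) :
    ‖exp (I * z * c) * w‖ ≤ ‖w‖ := by
  by_cases hw : w = 0
  · simp [hw]
  · rw [norm_mul, norm_exp]
    refine mul_le_of_le_one_left (norm_nonneg _) (Real.exp_le_one_iff.2 ?_)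
    have : (I * z * c).re = -(z.im * c) := by simp
    rw [this]
    linarith [mul_nonneg hz (hc hw)]

theorem aestronglyMeasurable_exp_mul (hf : AEStronglyMeasurable f μ) (hcm : Measurable c) (z : ℂ) :
    AEStronglyMeasurable (fun a => exp (I * z * c a) * f a) μ :=
  (Measurable.aestronglyMeasurable (by fun_prop)).mul hf

theorem integrable_exp_mul (hf : Integrable f μ) (hcm : Measurable c)
    (hc : ∀ a, f a ≠ 0 → 0 ≤ c a) {z : ℂ} (hz : 0 ≤ z.im) :
    Integrable (fun a => exp (I * z * c a) * f a) μ :=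
  hf.mono (aestronglyMeasurable_exp_mul hf.1 hcm z)
    (ae_of_all _ fun a => norm_exp_I_mul_mul_le hz (hc a))

theorem continuousOn_integral_exp_mul (hf : Integrable f μ) (hcm : Measurable c)
    (hc : ∀ a, f a ≠ 0 → 0 ≤ c a) :
    ContinuousOn (fun z : ℂ => ∫ a, exp (I * z * c a) * f a ∂μ) {z | 0 ≤ z.im} :=
  continuousOn_of_dominated (bound := fun a => ‖f a‖)
    (fun z _ => aestronglyMeasurable_exp_mul hf.1 hcm z)
    (fun _ hz => ae_of_all _ fun a => norm_exp_I_mul_mul_le hz (hc a)) hf.norm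
    (ae_of_all _ fun a => Continuous.continuousOn (by fun_prop))

/-- No moment of `c` is needed: for `Im z > Im z₀ / 2`, the damping gives `c e^{-c Im z} ≤ 2 / Im
z₀`. -/
theorem differentiableOn_integral_exp_mul (hf : Integrable f μ) (hcm : Measurable c)
    (hc : ∀ a, f a ≠ 0 → 0 ≤ c a) :
    DifferentiableOn ℂ (fun z : ℂ => ∫ a, exp (I * z * c a) * f a ∂μ) {z | 0 < z.im} := by
  intro z₀ hz₀
  have hz₀ : 0 < z₀.im := hz₀
  have hs : {z : ℂ | z₀.im / 2 < z.im} ∈ 𝓝 z₀ :=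
    (isOpen_lt continuous_const continuous_im).mem_nhds (by simpa using hz₀)
  have := hasDerivAt_integral_of_dominated_loc_of_deriv_le (μ := μ)
    (F := fun z a => exp (I * z * c a) * f a)
    (F' := fun z a => exp (I * z * c a) * (I * c a) * f a)
    (bound := fun a => 2 / z₀.im * ‖f a‖) hs
    (Eventually.of_forall fun z => aestronglyMeasurable_exp_mul hf.1 hcm z)
    (integrable_exp_mul hf hcm hc hz₀.le)
    ((Measurable.aestronglyMeasurable (by fun_prop)).mul hf.1) ?_ (hf.norm.const_mul _) ?_
  · exact this.2.differentiableAt.differentiableWithinAt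
  · refine ae_of_all _ fun a z hz => ?_
    have hz : z₀.im / 2 < z.im := hz
    rw [norm_mul]
    by_cases hfa : f a = 0
    · simp [hfa]
    · have hca := hc a hfa
      gcongr
      rw [norm_mul, norm_exp, norm_mul, norm_I, one_mul, norm_real, Real.norm_of_nonneg hca]
      have : (I * z * c a).re = -(z.im * c a) := by simp
      rw [this, Real.exp_neg, inv_mul_le_iff₀ (Real.exp_pos _)]
      have h1 := Real.add_one_le_exp (z.im * c a)
      have h2 : z₀.im / 2 * c a ≤ z.im * c a := by gcongr
      have h3 : c a = (z₀.im / 2 * c a) * (2 / z₀.im) := by field_simp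
      calc c a = (z₀.im / 2 * c a) * (2 / z₀.im) := h3
        _ ≤ Real.exp (z.im * c a) * (2 / z₀.im) := by gcongr; linarith
  · refine ae_of_all _ fun a z _ => ?_
    refine (HasDerivAt.cexp ?_).mul_const _
    have := ((hasDerivAt_id z).const_mul I).mul_const (c a : ℂ)
    simpa using this

end ExpIntegral

/-! ### A weighted tail identity -/

section Hardy

open ENNReal

theorem lintegral_Ioi_rpow_neg {s : ℝ} (hs : 0 < s) :
    ∫⁻ t in Ioi s, ENNReal.ofReal (t ^ (-(3 / 2) : ℝ)) =
      ENNReal.ofReal (2 * s ^ (-(1 / 2) : ℝ)) := by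
  rw [← ofReal_integral_eq_lintegral_ofReal (integrableOn_Ioi_rpow_of_lt (by norm_num) hs)]
  · rw [integral_Ioi_rpow_of_lt (by norm_num) hs]
    congr 1
    norm_num
    ring
  · filter_upwards [ae_restrict_mem measurableSet_Ioi] with t ht
    exact Real.rpow_nonneg (hs.trans ht).le _

theorem lintegral_Ioo_rpow_neg {x : ℝ} (hx : 0 < x) :
    ∫⁻ s in Ioo 0 x, ENNReal.ofReal (2 * s ^ (-(1 / 2) : ℝ)) =
      ENNReal.ofReal (4 * x ^ (1 / 2 : ℝ)) := by
  have h1 : IntervalIntegrable (fun s : ℝ => 2 * s ^ (-(1 / 2) : ℝ)) volume 0 x :=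
    (intervalIntegral.intervalIntegrable_rpow' (by norm_num)).const_mul 2
  rw [setLIntegral_congr Ioo_ae_eq_Ioc, ← ofReal_integral_eq_lintegral_ofReal
    ((intervalIntegrable_iff_integrableOn_Ioc_of_le hx.le).1 h1)]
  · rw [← intervalIntegral.integral_of_le hx.le, intervalIntegral.integral_const_mul,
      integral_rpow (Or.inl (by norm_num))]
    congr 1
    norm_num
    ring
  · filter_upwards [ae_restrict_mem measurableSet_Ioc] with s hs
    exact mul_nonneg two_pos.le (Real.rpow_nonneg hs.1.le _)

/-- The weighted identity behind Hardy's inequality. -/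
theorem lintegral_weighted_tail {a : ℝ → ℝ≥0∞} (ha : AEMeasurable a (volume.restrict (Ioi 0))) :
    ∫⁻ s in Ioi 0, (∫⁻ x in Ioi 0, (Ioi s).indicator a x) *
      (∫⁻ t in Ioi 0, (Ioi s).indicator (fun t => ENNReal.ofReal (t ^ (-(3 / 2) : ℝ))) t) =
    ∫⁻ x in Ioi 0, a x * ENNReal.ofReal (4 * x ^ (1 / 2 : ℝ)) := by
  have hm : AEMeasurable (fun p : ℝ × ℝ => (Ioi p.1).indicator a p.2 *
      ENNReal.ofReal (2 * p.1 ^ (-(1 / 2) : ℝ)))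
      ((volume.restrict (Ioi 0)).prod (volume.restrict (Ioi 0))) := by
    refine AEMeasurable.mul ?_ (by fun_prop)
    have : (fun p : ℝ × ℝ => (Ioi p.1).indicator a p.2) =
        {p : ℝ × ℝ | p.1 < p.2}.indicator (fun p => a p.2) := by
      ext p; simp [indicator]
    rw [this]
    exact ha.comp_snd.indicator (measurableSet_lt measurable_fst measurable_snd)
  -- The tail of `t^(-3/2)` beyond `s` is `2 s^(-1/2)`; after Tonelli its integral over `0 < s < x`
  -- is `4 x^(1/2)`.
  calc _ = ∫⁻ s in Ioi 0, ∫⁻ x in Ioi 0, (Ioi s).indicator a x *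
        ENNReal.ofReal (2 * s ^ (-(1 / 2) : ℝ)) := by
        refine setLIntegral_congr_fun measurableSet_Ioi fun s hs => ?_
        have hs : (0 : ℝ) < s := hs
        rw [lintegral_indicator measurableSet_Ioi, lintegral_indicator measurableSet_Ioi,
          Measure.restrict_restrict measurableSet_Ioi,
          inter_eq_self_of_subset_left (Ioi_subset_Ioi hs.le), lintegral_Ioi_rpow_neg hs,
          ← lintegral_mul_const' _ _ ofReal_ne_top, ← lintegral_indicator measurableSet_Ioi,
          ← lintegral_indicator measurableSet_Ioi]
        refine lintegral_congr fun x => ?_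
        by_cases hx : s < x
        · simp [indicator, hx, hs.trans hx]
        · simp [indicator, hx]
    _ = ∫⁻ x in Ioi 0, ∫⁻ s in Ioi 0, (Ioi s).indicator a x *
        ENNReal.ofReal (2 * s ^ (-(1 / 2) : ℝ)) := lintegral_lintegral_swap hm
    _ = _ := by
        refine setLIntegral_congr_fun measurableSet_Ioi fun x hx => ?_
        have hx : (0 : ℝ) < x := hx
        rw [← lintegral_Ioo_rpow_neg hx, ← lintegral_const_mul'' _ (by fun_prop),
          ← lintegral_indicator measurableSet_Ioo, ← lintegral_indicator measurableSet_Ioi]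
        refine lintegral_congr fun s => ?_
        simp only [indicator, mem_Ioi, mem_Ioo]
        split_ifs <;> simp_all

end Hardy

/-! ### The free resolvent form as a path integral -/

section Resolvent

open ComplexConjugate ENNReal

variable {v : ℝ → ℂ}

/-- Lebesgue measure on the half-line. -/
noncomputable abbrev halfLine : Measure ℝ := volume.restrict (Ioi (0 : ℝ))

/-- The amplitude `1_{s < x} 1_{s < t} v(x) conj (v(t))` at the point `(s, x, t)`. -/
noncomputable def amplitude (v : ℝ → ℂ) (p : ℝ × ℝ × ℝ) : ℂ :=
  (Ioi p.1).indicator v p.2.1 * conj ((Ioi p.1).indicator v p.2.2)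

/-- The travelled distance `(x - s) + (t - s)`. -/
def pathLength (p : ℝ × ℝ × ℝ) : ℝ := p.2.1 + p.2.2 - 2 * p.1

/-- The matrix element `⟨R₀(z²) v, v⟩` of the resolvent of the half-line Dirichlet Laplacian, for
`z` in the closed upper half-plane. -/
noncomputable def resolventForm (v : ℝ → ℂ) (z : ℂ) : ℂ :=
  ∫ p, Complex.exp (Complex.I * z * pathLength p) * amplitude v p
    ∂(halfLine.prod (halfLine.prod halfLine))

theorem measurable_pathLength : Measurable pathLength := by
  unfold pathLength; fun_prop

theorem pathLength_nonneg {p : ℝ × ℝ × ℝ} (h : amplitude v p ≠ 0) : 0 ≤ pathLength p := by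
  have h1 := left_ne_zero_of_mul h
  have h2 := right_ne_zero_of_mul h
  rw [map_ne_zero] at h2
  have h1 : p.1 < p.2.1 := by
    by_contra hn; exact h1 (indicator_of_notMem (by simpa using hn) _)
  have h2 : p.1 < p.2.2 := by
    by_contra hn; exact h2 (indicator_of_notMem (by simpa using hn) _)
  unfold pathLength
  linarith

theorem aestronglyMeasurable_tail {ι : Type*} [MeasurableSpace ι] {ν : Measure ι}
    {f : ι → ℝ} {k : ι → ℝ} (hf : Measurable f) (hk : Measurable k)
    (hv : AEStronglyMeasurable (fun p => v (k p)) ν) :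
    AEStronglyMeasurable (fun p => (Ioi (f p)).indicator v (k p)) ν := by
  have : (fun p => (Ioi (f p)).indicator v (k p)) =
      {p | f p < k p}.indicator (fun p => v (k p)) := by
    ext p; simp [indicator]
  rw [this]
  exact hv.indicator (measurableSet_lt hf hk)

theorem aestronglyMeasurable_amplitude (hm : AEStronglyMeasurable v halfLine) :
    AEStronglyMeasurable (amplitude v) (halfLine.prod (halfLine.prod halfLine)) := by
  have h1 : AEStronglyMeasurable (fun p : ℝ × ℝ × ℝ => v p.2.1)
      (halfLine.prod (halfLine.prod halfLine)) := hm.comp_fst.comp_snd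
  have h2 : AEStronglyMeasurable (fun p : ℝ × ℝ × ℝ => v p.2.2)
      (halfLine.prod (halfLine.prod halfLine)) := hm.comp_snd.comp_snd
  exact (aestronglyMeasurable_tail measurable_fst (by fun_prop) h1).mul
    (RCLike.continuous_conj.comp_aestronglyMeasurable
      (aestronglyMeasurable_tail measurable_fst (by fun_prop) h2))

theorem mul_le_weighted_sq {A B m : ℝ} (hm : 0 < m) :
    A * B ≤ A ^ 2 * m + B ^ 2 * m⁻¹ := by
  have h : 0 ≤ (A * m - B) ^ 2 * m⁻¹ := by positivity
  have h1 : (A * m - B) ^ 2 * m⁻¹ = A ^ 2 * m + B ^ 2 * m⁻¹ - 2 * (A * B) := by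
    field_simp; ring
  have h2 : 0 ≤ A ^ 2 * m + B ^ 2 * m⁻¹ := by positivity
  linarith

/-- Hardy's inequality by a weighted AM-GM bound: `‖v x‖‖v t‖ ≤ ‖v x‖² m + ‖v t‖² / m` with `m =
(x/t)^(3/2)`. Integrating the first term over `t` and then `s` leaves `4 ∫ x²‖v x‖² dx`, which the
second moment of `v` controls; the second term is its mirror image. -/
theorem integrable_amplitude (hm : AEStronglyMeasurable v halfLine)
    (hv : IntegrableOn (fun x : ℝ => (1 + x ^ 2) * ‖v x‖ ^ 2) (Ioi (0 : ℝ))) :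
    Integrable (amplitude v) (halfLine.prod (halfLine.prod halfLine)) := by
  refine ⟨aestronglyMeasurable_amplitude hm, ?_⟩
  set a : ℝ → ℝ≥0∞ := fun x => ENNReal.ofReal (‖v x‖ ^ 2 * x ^ (3 / 2 : ℝ)) with ha
  set b : ℝ → ℝ≥0∞ := fun t => ENNReal.ofReal (t ^ (-(3 / 2) : ℝ)) with hb
  have ham : AEMeasurable a halfLine :=
    ((hm.norm.aemeasurable.pow_const 2).mul (by fun_prop)).ennreal_ofReal
  have hbm : Measurable b := by fun_prop
  have hfin : ∫⁻ s in Ioi 0, (∫⁻ x in Ioi 0, (Ioi s).indicator a x) *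
      (∫⁻ t in Ioi 0, (Ioi s).indicator b t) < ∞ := by
    rw [lintegral_weighted_tail ham]
    refine lt_of_le_of_lt (setLIntegral_mono' measurableSet_Ioi (g := fun x =>
      4 * ENNReal.ofReal ((1 + x ^ 2) * ‖v x‖ ^ 2)) fun x hx => ?_) ?_
    · have hx : (0 : ℝ) < x := hx
      have h4 : (4 : ℝ≥0∞) = ENNReal.ofReal 4 := by simp
      rw [ha, h4, ← ENNReal.ofReal_mul (by positivity), ← ENNReal.ofReal_mul (by norm_num)]
      refine ENNReal.ofReal_le_ofReal ?_
      have : x ^ (3 / 2 : ℝ) * x ^ (1 / 2 : ℝ) = x ^ 2 := by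
        rw [← Real.rpow_add hx, ← Real.rpow_natCast]; norm_num
      calc _ = 4 * (‖v x‖ ^ 2 * (x ^ (3 / 2 : ℝ) * x ^ (1 / 2 : ℝ))) := by ring
        _ ≤ _ := by rw [this]; nlinarith [sq_nonneg ‖v x‖]
    · rw [lintegral_const_mul' _ _ (by simp)]
      exact ENNReal.mul_lt_top (by simp) hv.lintegral_lt_top
  have hind1 : ∀ k : ℝ → ℝ≥0∞, AEMeasurable k halfLine → ∀ s : ℝ,
      AEMeasurable ((Ioi s).indicator k) halfLine := fun k hk s =>
    hk.indicator measurableSet_Ioi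
  have hM : ∀ k₁ k₂ : ℝ → ℝ≥0∞, AEMeasurable k₁ halfLine → AEMeasurable k₂ halfLine →
      AEMeasurable (fun p : ℝ × ℝ × ℝ => (Ioi p.1).indicator k₁ p.2.1 *
        (Ioi p.1).indicator k₂ p.2.2) (halfLine.prod (halfLine.prod halfLine)) := by
    intro k₁ k₂ hk₁ hk₂
    have e1 : (fun p : ℝ × ℝ × ℝ => (Ioi p.1).indicator k₁ p.2.1) =
        {p : ℝ × ℝ × ℝ | p.1 < p.2.1}.indicator (fun p => k₁ p.2.1) := by
      ext p; simp [indicator]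
    have e2 : (fun p : ℝ × ℝ × ℝ => (Ioi p.1).indicator k₂ p.2.2) =
        {p : ℝ × ℝ × ℝ | p.1 < p.2.2}.indicator (fun p => k₂ p.2.2) := by
      ext p; simp [indicator]
    refine AEMeasurable.mul ?_ ?_
    · rw [e1]
      exact AEMeasurable.indicator (hk₁.comp_fst.comp_snd)
        (measurableSet_lt measurable_fst (by fun_prop))
    · rw [e2]
      exact AEMeasurable.indicator (hk₂.comp_snd.comp_snd)
        (measurableSet_lt measurable_fst (by fun_prop))
  have hprod : ∀ k₁ k₂ : ℝ → ℝ≥0∞, AEMeasurable k₁ halfLine → AEMeasurable k₂ halfLine →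
      ∫⁻ p : ℝ × ℝ × ℝ, (Ioi p.1).indicator k₁ p.2.1 * (Ioi p.1).indicator k₂ p.2.2
        ∂(halfLine.prod (halfLine.prod halfLine)) =
      ∫⁻ s in Ioi 0, (∫⁻ x in Ioi 0, (Ioi s).indicator k₁ x) *
        (∫⁻ t in Ioi 0, (Ioi s).indicator k₂ t) := by
    intro k₁ k₂ hk₁ hk₂
    rw [lintegral_prod _ (hM k₁ k₂ hk₁ hk₂)]
    exact lintegral_congr fun s => lintegral_prod_mul (hind1 k₁ hk₁ s) (hind1 k₂ hk₂ s)
  rw [hasFiniteIntegral_iff_enorm]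
  have hpos : ∀ᵐ p : ℝ × ℝ × ℝ ∂(halfLine.prod (halfLine.prod halfLine)),
      0 < p.2.1 ∧ 0 < p.2.2 := by
    have hq : ∀ᵐ q : ℝ × ℝ ∂(halfLine.prod halfLine), 0 < q.1 ∧ 0 < q.2 := by
      rw [Measure.prod_restrict]
      filter_upwards [ae_restrict_mem (measurableSet_Ioi.prod measurableSet_Ioi)] with q hq
      exact hq
    exact Measure.quasiMeasurePreserving_snd.ae hq
  refine lt_of_le_of_lt (lintegral_mono_ae (g := fun p : ℝ × ℝ × ℝ =>
    (Ioi p.1).indicator a p.2.1 * (Ioi p.1).indicator b p.2.2 +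
    (Ioi p.1).indicator b p.2.1 * (Ioi p.1).indicator a p.2.2) ?_) ?_
  · filter_upwards [hpos] with p hp
    obtain ⟨hx, ht⟩ := hp
    rw [amplitude]
    by_cases h1 : p.1 < p.2.1
    · by_cases h2 : p.1 < p.2.2
      · have hx' := Real.rpow_pos_of_pos hx (3 / 2)
        have ht' := Real.rpow_pos_of_pos ht (3 / 2)
        rw [indicator_of_mem (show p.2.1 ∈ Ioi p.1 from h1),
          indicator_of_mem (show p.2.2 ∈ Ioi p.1 from h2),
          indicator_of_mem (show p.2.1 ∈ Ioi p.1 from h1),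
          indicator_of_mem (show p.2.2 ∈ Ioi p.1 from h2),
          indicator_of_mem (show p.2.1 ∈ Ioi p.1 from h1),
          indicator_of_mem (show p.2.2 ∈ Ioi p.1 from h2), ha, hb]
        rw [← ENNReal.ofReal_mul (by positivity), ← ENNReal.ofReal_mul (by positivity),
          ← ENNReal.ofReal_add (by positivity) (by positivity), ← ofReal_norm]
        refine ENNReal.ofReal_le_ofReal ?_
        rw [norm_mul, RCLike.norm_conj, Real.rpow_neg hx.le, Real.rpow_neg ht.le]
        refine (mul_le_weighted_sq (m := p.2.1 ^ (3 / 2 : ℝ) * (p.2.2 ^ (3 / 2 : ℝ))⁻¹)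
          (by positivity)).trans_eq ?_
        rw [mul_inv, inv_inv]
        ring
      · simp [h2]
    · simp [h1]
  · rw [lintegral_add_left' (hM a b ham hbm.aemeasurable), hprod a b ham hbm.aemeasurable,
      hprod b a hbm.aemeasurable ham]
    simp only [mul_comm (∫⁻ x in Ioi 0, (Ioi _).indicator b x)]
    exact ENNReal.add_lt_top.2 ⟨hfin, hfin⟩

theorem integrable_exp_mul_amplitude (hm : AEStronglyMeasurable v halfLine)
    (hv : IntegrableOn (fun x : ℝ => (1 + x ^ 2) * ‖v x‖ ^ 2) (Ioi (0 : ℝ))) {z : ℂ}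
    (hz : 0 ≤ z.im) :
    Integrable (fun p => Complex.exp (Complex.I * z * pathLength p) * amplitude v p)
      (halfLine.prod (halfLine.prod halfLine)) :=
  integrable_exp_mul (integrable_amplitude hm hv) measurable_pathLength
    (fun _ => pathLength_nonneg) hz

theorem continuousOn_resolventForm (hm : AEStronglyMeasurable v halfLine)
    (hv : IntegrableOn (fun x : ℝ => (1 + x ^ 2) * ‖v x‖ ^ 2) (Ioi (0 : ℝ))) :
    ContinuousOn (resolventForm v) {z | 0 ≤ z.im} :=
  continuousOn_integral_exp_mul (integrable_amplitude hm hv) measurable_pathLength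
    (fun _ => pathLength_nonneg)

theorem differentiableOn_resolventForm (hm : AEStronglyMeasurable v halfLine)
    (hv : IntegrableOn (fun x : ℝ => (1 + x ^ 2) * ‖v x‖ ^ 2) (Ioi (0 : ℝ))) :
    DifferentiableOn ℂ (resolventForm v) {z | 0 < z.im} :=
  differentiableOn_integral_exp_mul (integrable_amplitude hm hv) measurable_pathLength
    (fun _ => pathLength_nonneg)

theorem resolventForm_eq_integral_integral (hm : AEStronglyMeasurable v halfLine)
    (hv : IntegrableOn (fun x : ℝ => (1 + x ^ 2) * ‖v x‖ ^ 2) (Ioi (0 : ℝ))) {z : ℂ}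
    (hz : 0 ≤ z.im) :
    resolventForm v z = ∫ s in Ioi (0 : ℝ), ∫ q : ℝ × ℝ,
      Complex.exp (Complex.I * z * pathLength (s, q)) * amplitude v (s, q)
        ∂(halfLine.prod halfLine) :=
  integral_prod _ (integrable_exp_mul_amplitude hm hv hz)

/-- Replacing `z` by `-conj z` conjugates the exponential, and exchanging `x` with `t` conjugates
the amplitude. -/
theorem resolventForm_symm (hm : AEStronglyMeasurable v halfLine)
    (hv : IntegrableOn (fun x : ℝ => (1 + x ^ 2) * ‖v x‖ ^ 2) (Ioi (0 : ℝ))) {z : ℂ}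
    (hz : 0 ≤ z.im) : resolventForm v (-conj z) = conj (resolventForm v z) := by
  rw [resolventForm_eq_integral_integral hm hv hz,
    resolventForm_eq_integral_integral hm hv (by simpa using hz), ← integral_conj]
  congr 1
  ext s
  rw [← integral_conj, ← integral_prod_swap]
  congr 1
  ext q
  simp only [amplitude, pathLength, Prod.swap, map_mul, Complex.conj_conj, ← Complex.exp_conj,
    Complex.conj_I, Complex.conj_ofReal]
  rw [mul_comm ((Ioi s).indicator v q.2)]
  congr 2
  push_cast
  ring

/-- At `z = iy` the exponential factors as `e^{-y(x-s)} e^{-y(t-s)}`, so for fixed `s` the integral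
over `(x, t)` is a squared modulus. -/
theorem resolventForm_imag_re_nonneg (hm : AEStronglyMeasurable v halfLine)
    (hv : IntegrableOn (fun x : ℝ => (1 + x ^ 2) * ‖v x‖ ^ 2) (Ioi (0 : ℝ))) {y : ℝ}
    (hy : 0 ≤ y) : 0 ≤ (resolventForm v (y * Complex.I)).re := by
  rw [resolventForm_eq_integral_integral hm hv (by simpa using hy)]
  have : ∀ s : ℝ, ∫ q : ℝ × ℝ,
      Complex.exp (Complex.I * (y * Complex.I) * pathLength (s, q)) * amplitude v (s, q)
        ∂(halfLine.prod halfLine) =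
      ((Complex.normSq (∫ x in Ioi (0 : ℝ), Complex.exp (-y * (x - s)) *
        (Ioi s).indicator v x) : ℝ) : ℂ) := by
    intro s
    rw [← Complex.mul_conj, ← integral_conj, ← integral_prod_mul]
    congr 1
    ext q
    rw [map_mul, ← Complex.exp_conj]
    simp only [amplitude, pathLength]
    have e : Complex.exp (Complex.I * (y * Complex.I) * ((q.1 + q.2 - 2 * s : ℝ) : ℂ)) =
        Complex.exp (-y * (q.1 - s)) * Complex.exp (conj (-y * (q.2 - s) : ℂ)) := by
      rw [← Complex.exp_add]
      congr 1
      simp only [map_mul, map_neg, map_sub, Complex.conj_ofReal]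
      push_cast
      linear_combination (y * (q.1 + q.2 - 2 * s) : ℂ) * Complex.I_mul_I
    rw [e]
    ring
  simp only [this]
  rw [integral_complex_ofReal, Complex.ofReal_re]
  exact integral_nonneg fun s => Complex.normSq_nonneg _

end Resolvent

/-! ### Boundary values on the real axis and the scattering data -/

section BoundaryValues

open ComplexConjugate

variable {v : ℝ → ℂ}

theorem integrable_of_weighted (hm : AEStronglyMeasurable v halfLine)
    (hv : IntegrableOn (fun x : ℝ => (1 + x ^ 2) * ‖v x‖ ^ 2) (Ioi (0 : ℝ))) :
    Integrable v halfLine := by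
  refine Integrable.mono' (g := fun x : ℝ => (1 + x ^ 2) * ‖v x‖ ^ 2 + (1 + x ^ 2)⁻¹)
    (Integrable.add hv integrable_inv_one_add_sq.integrableOn) hm (ae_of_all _ fun x => ?_)
  have := mul_le_weighted_sq (A := ‖v x‖) (B := 1) (m := 1 + x ^ 2) (by positivity)
  linarith

theorem integrable_sq_of_weighted (hm : AEStronglyMeasurable v halfLine)
    (hv : IntegrableOn (fun x : ℝ => (1 + x ^ 2) * ‖v x‖ ^ 2) (Ioi (0 : ℝ))) :
    Integrable (fun x => ‖v x‖ ^ 2) halfLine := by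
  refine Integrable.mono' hv (hm.norm.pow 2) (ae_of_all _ fun x => ?_)
  rw [Real.norm_of_nonneg (by positivity)]
  nlinarith [mul_nonneg (sq_nonneg x) (sq_nonneg ‖v x‖)]

/-- Integrating out `s` over `(0, min x t)` recovers the Dirichlet Green kernel given by the method
of images, since `|x - t| = x + t - 2 min x t`. -/
theorem integral_amplitude_section {z : ℂ} (hz : z ≠ 0) {x t : ℝ} (hx : 0 < x) (ht : 0 < t) :
    ∫ s in Ioi (0 : ℝ), Complex.exp (Complex.I * z * pathLength (s, x, t)) *
        amplitude v (s, x, t) =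
      (2 * Complex.I * z)⁻¹ * ((Complex.exp (Complex.I * z * (x + t)) -
        Complex.exp (Complex.I * z * |x - t|)) * (v x * conj (v t))) := by
  have hm : 0 < min x t := lt_min hx ht
  have e : ∀ s, Complex.exp (Complex.I * z * pathLength (s, x, t)) * amplitude v (s, x, t) =
      (Iio (min x t)).indicator (fun s : ℝ => Complex.exp (Complex.I * z * (x + t)) *
        (v x * conj (v t)) * Complex.exp (-2 * Complex.I * z * s)) s := by
    intro s
    simp only [amplitude, pathLength, indicator, mem_Ioi, mem_Iio, lt_min_iff]
    by_cases h1 : s < x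
    · by_cases h2 : s < t
      · rw [if_pos h1, if_pos h2, if_pos ⟨h1, h2⟩, mul_right_comm _ _ (Complex.exp _),
          ← Complex.exp_add]
        congr 2
        push_cast
        ring
      · simp [h2]
    · simp [h1]
  have hz2 : -2 * Complex.I * z ≠ 0 := by simp [hz]
  simp only [e]
  rw [setIntegral_indicator measurableSet_Iio, Ioi_inter_Iio, ← integral_Ioc_eq_integral_Ioo,
    ← intervalIntegral.integral_of_le hm.le, intervalIntegral.integral_const_mul,
    integral_exp_mul_complex hz2]
  have habs : |x - t| = x + t - 2 * min x t := by
    rcases le_total x t with h | h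
    · rw [min_eq_left h, abs_of_nonpos (by linarith)]; ring
    · rw [min_eq_right h, abs_of_nonneg (by linarith)]; ring
  have h2 : Complex.exp (Complex.I * z * |x - t|) = Complex.exp (Complex.I * z * (x + t)) *
      Complex.exp (-2 * Complex.I * z * (min x t : ℝ)) := by
    rw [habs, ← Complex.exp_add]
    congr 1
    push_cast
    ring
  rw [h2, Complex.ofReal_zero, mul_zero, Complex.exp_zero]
  field_simp
  ring

theorem resolventForm_eq_integral_prod (hm : AEStronglyMeasurable v halfLine)
    (hv : IntegrableOn (fun x : ℝ => (1 + x ^ 2) * ‖v x‖ ^ 2) (Ioi (0 : ℝ))) {z : ℂ}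
    (hz : 0 ≤ z.im) (hz0 : z ≠ 0) :
    resolventForm v z = (2 * Complex.I * z)⁻¹ * ∫ q : ℝ × ℝ,
      (Complex.exp (Complex.I * z * (q.1 + q.2)) -
        Complex.exp (Complex.I * z * |q.1 - q.2|)) * (v q.1 * conj (v q.2))
        ∂(halfLine.prod halfLine) := by
  rw [resolventForm, integral_prod_symm _ (integrable_exp_mul_amplitude hm hv hz),
    ← integral_const_mul]
  refine integral_congr_ae ?_
  rw [Measure.prod_restrict]
  filter_upwards [ae_restrict_mem (measurableSet_Ioi.prod measurableSet_Ioi)] with q hq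
  exact integral_amplitude_section hz0 hq.1 hq.2

/-- The path formula bounds the form uniformly, also near `z = 0`; the Green kernel, with its factor
`1/(2iz)`, bounds `‖z‖` times the form. -/
theorem resolventForm_bound (hm : AEStronglyMeasurable v halfLine)
    (hv : IntegrableOn (fun x : ℝ => (1 + x ^ 2) * ‖v x‖ ^ 2) (Ioi (0 : ℝ))) :
    ∃ C : ℝ, ∀ z : ℂ, 0 ≤ z.im → ‖resolventForm v z‖ ≤ C / (1 + ‖z‖) := by
  set C₀ := ∫ p, ‖amplitude v p‖ ∂(halfLine.prod (halfLine.prod halfLine))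
  set C₁ := ∫ q : ℝ × ℝ, ‖v q.1‖ * ‖v q.2‖ ∂(halfLine.prod halfLine)
  have hi := integrable_of_weighted hm hv
  have hint : Integrable (fun q : ℝ × ℝ => ‖v q.1‖ * ‖v q.2‖) (halfLine.prod halfLine) :=
    hi.norm.mul_prod hi.norm
  refine ⟨C₀ + C₁, fun z hz => ?_⟩
  rw [le_div_iff₀ (by positivity), mul_add, mul_one]
  refine add_le_add ?_ ?_
  · exact norm_integral_le_of_norm_le (integrable_amplitude hm hv).norm
      (ae_of_all _ fun p => norm_exp_I_mul_mul_le hz pathLength_nonneg)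
  · by_cases hz0 : z = 0
    · rw [hz0, norm_zero, mul_zero]
      exact integral_nonneg fun q => by positivity
    · have hzn : 0 < ‖z‖ := norm_pos_iff.2 hz0
      rw [resolventForm_eq_integral_prod hm hv hz hz0, norm_mul, norm_inv, norm_mul, norm_mul,
        Complex.norm_I, mul_one]
      have h2 : ‖(2 : ℂ)‖ = 2 := by simp
      rw [h2]
      have hle : ‖∫ q : ℝ × ℝ, (Complex.exp (Complex.I * z * (q.1 + q.2)) -
          Complex.exp (Complex.I * z * |q.1 - q.2|)) * (v q.1 * conj (v q.2))
          ∂(halfLine.prod halfLine)‖ ≤ ∫ q : ℝ × ℝ, 2 * (‖v q.1‖ * ‖v q.2‖)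
          ∂(halfLine.prod halfLine) := by
        refine norm_integral_le_of_norm_le (hint.const_mul 2) ?_
        rw [Measure.prod_restrict]
        filter_upwards [ae_restrict_mem (measurableSet_Ioi.prod measurableSet_Ioi)] with q hq
        have hq1 : 0 < q.1 := hq.1
        have hq2 : 0 < q.2 := hq.2
        rw [norm_mul, norm_mul, RCLike.norm_conj]
        gcongr
        have hexp : ∀ c : ℝ, 0 ≤ c → ‖Complex.exp (Complex.I * z * c)‖ ≤ 1 := fun c hc => by
          have := norm_exp_I_mul_mul_le (w := 1) hz (fun _ => hc)
          simpa using this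
        have h1 := hexp (q.1 + q.2) (by positivity)
        have h2 := hexp |q.1 - q.2| (abs_nonneg _)
        push_cast at h1
        refine (norm_sub_le _ _).trans ?_
        linarith
      rw [integral_const_mul] at hle
      refine (mul_le_mul_of_nonneg_right (mul_le_mul_of_nonneg_left hle (by positivity))
        hzn.le).trans_eq ?_
      field_simp
      rfl

/-- The part `x < t` of the integrand of `|ṽ(-l)|²`. -/
noncomputable def causal (v : ℝ → ℂ) (l : ℝ) (q : ℝ × ℝ) : ℂ :=
  Complex.exp (Complex.I * l * (q.2 - q.1)) * ((Ioi q.1).indicator v q.2 * conj (v q.1))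

theorem norm_exp_I_mul_real (l c : ℝ) : ‖Complex.exp (Complex.I * l * c)‖ = 1 := by
  have : Complex.I * l * c = ((l * c : ℝ) : ℂ) * Complex.I := by push_cast; ring
  rw [this, Complex.norm_exp_ofReal_mul_I]

theorem integrable_causal (hi : Integrable v halfLine) (l : ℝ) :
    Integrable (causal v l) (halfLine.prod halfLine) := by
  refine Integrable.mono (hi.norm.mul_prod hi.norm) ?_ (ae_of_all _ fun q => ?_)
  · refine AEStronglyMeasurable.mul (Measurable.aestronglyMeasurable (by fun_prop)) ?_
    exact (aestronglyMeasurable_tail measurable_fst measurable_snd hi.1.comp_snd).mul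
      (RCLike.continuous_conj.comp_aestronglyMeasurable hi.1.comp_fst)
  · have h := norm_exp_I_mul_real l (q.2 - q.1)
    push_cast at h
    rw [causal, norm_mul, h, one_mul, norm_mul, RCLike.norm_conj, norm_mul, norm_norm, norm_norm,
      mul_comm]
    gcongr
    exact norm_indicator_le_norm_self _ _

theorem ae_prod_ne : ∀ᵐ q : ℝ × ℝ ∂(halfLine.prod halfLine), q.1 ≠ q.2 := by
  have hms : MeasurableSet {q : ℝ × ℝ | q.1 = q.2} :=
    measurableSet_eq_fun measurable_fst measurable_snd
  have : (halfLine.prod halfLine) {q : ℝ × ℝ | q.1 = q.2} = 0 := by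
    rw [Measure.measure_prod_null hms]
    refine ae_of_all _ fun x => ?_
    have : Prod.mk x ⁻¹' {q : ℝ × ℝ | q.1 = q.2} = {x} := by
      ext y; simp [eq_comm]
    change halfLine (Prod.mk x ⁻¹' _) = 0
    rw [this]
    exact measure_singleton x
  rw [ae_iff]
  simpa using this

theorem integral_causal (hi : Integrable v halfLine) (l : ℝ) :
    ∫ q, causal v l q ∂(halfLine.prod halfLine) = conj (Phi v l) := by
  -- The substitution `t = x + y` is a measure-preserving shear of the whole plane, not of the
  -- quadrant, hence the extension by zero.
  set G : ℝ × ℝ → ℂ := (Ioi (0 : ℝ) ×ˢ Ioi (0 : ℝ)).indicator (causal v l)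
  have hms : MeasurableSet (Ioi (0 : ℝ) ×ˢ Ioi (0 : ℝ)) := measurableSet_Ioi.prod measurableSet_Ioi
  have hG : Integrable G (volume.prod volume) := by
    have := integrable_causal hi l
    rw [Measure.prod_restrict] at this
    exact (integrable_indicator_iff hms).2 this
  have hmp : MeasurePreserving (MeasurableEquiv.shearAddRight ℝ)
      ((volume : Measure ℝ).prod volume) (volume.prod volume) :=
    measurePreserving_prod_add volume volume
  have hG' := (hmp.integrable_comp_emb (MeasurableEquiv.measurableEmbedding _)).2 hG
  have hsh : ∀ x y : ℝ, MeasurableEquiv.shearAddRight ℝ (x, y) = (x, x + y) := fun _ _ => rfl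
  have hshear : ∫ q, G q ∂(volume.prod volume) =
      ∫ q, (G ∘ MeasurableEquiv.shearAddRight ℝ) q ∂(volume.prod volume) :=
    (hmp.integral_comp (MeasurableEquiv.measurableEmbedding _) G).symm
  rw [Measure.prod_restrict, ← integral_indicator hms, hshear, integral_prod_symm _ hG', Phi,
    ← integral_conj,
    ← integral_indicator measurableSet_Ioi]
  congr 1
  ext y
  by_cases hy : 0 < y
  · rw [indicator_of_mem (show y ∈ Ioi 0 from hy), map_mul, g, ← integral_conj,
      ← integral_const_mul, ← integral_indicator measurableSet_Ioi]
    congr 1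
    ext x
    by_cases hx : 0 < x
    · have hxy : 0 < x + y := by linarith
      simp [G, hsh, causal, hx, hxy, indicator, hy, ← Complex.exp_conj]
    · simp [G, hsh, hx]
  · rw [indicator_of_notMem (show y ∉ Ioi 0 from hy)]
    refine integral_eq_zero_of_ae (ae_of_all _ fun x => ?_)
    simp [G, hsh, causal, indicator, hy]

theorem vTilde_neg (l : ℝ) :
    vTilde v (-l) = ∫ x in Ioi (0 : ℝ), Complex.exp (Complex.I * l * x) * v x := by
  simp [vTilde]

theorem conj_vTilde (l : ℝ) :
    conj (vTilde v l) = ∫ x in Ioi (0 : ℝ), Complex.exp (Complex.I * l * x) * conj (v x) := by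
  rw [vTilde, ← integral_conj]
  simp [← Complex.exp_conj]

theorem causal_of_lt {l : ℝ} {q : ℝ × ℝ} (h : q.1 < q.2) :
    causal v l q = Complex.exp (Complex.I * l * (q.2 - q.1)) * (v q.2 * conj (v q.1)) := by
  rw [causal, indicator_of_mem (show q.2 ∈ Ioi q.1 from h)]

theorem causal_of_le {l : ℝ} {q : ℝ × ℝ} (h : q.2 ≤ q.1) : causal v l q = 0 := by
  rw [causal, indicator_of_notMem (show q.2 ∉ Ioi q.1 from not_lt.2 h), zero_mul, mul_zero]

theorem integral_conj_causal (hi : Integrable v halfLine) (l : ℝ) :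
    ∫ q, conj (causal v l q) ∂(halfLine.prod halfLine) = Phi v l := by
  rw [integral_conj, integral_causal hi, Complex.conj_conj]

theorem integral_causal_swap (hi : Integrable v halfLine) (l : ℝ) :
    ∫ q : ℝ × ℝ, causal v l q.swap ∂(halfLine.prod halfLine) = conj (Phi v l) := by
  rw [integral_prod_swap, integral_causal hi]

theorem integrable_conj_causal (hi : Integrable v halfLine) (l : ℝ) :
    Integrable (fun q => conj (causal v l q)) (halfLine.prod halfLine) :=
  (RCLike.conjCLE (K := ℂ)).toContinuousLinearMap.integrable_comp (integrable_causal hi l)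

theorem integrable_causal_swap (hi : Integrable v halfLine) (l : ℝ) :
    Integrable (fun q : ℝ × ℝ => causal v l q.swap) (halfLine.prod halfLine) :=
  (integrable_causal hi l).swap

theorem conj_causal_of_lt {l : ℝ} {q : ℝ × ℝ} (h : q.1 < q.2) :
    conj (causal v (-l) q) =
      Complex.exp (Complex.I * l * (q.2 - q.1)) * (v q.1 * conj (v q.2)) := by
  rw [causal_of_lt h, map_mul, map_mul, Complex.conj_conj, ← Complex.exp_conj, mul_comm (v q.1)]
  congr 2
  simp

/-- Up to the null diagonal the quadrant splits into the triangles `x < t` and `t < x`, which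
contribute conjugate autocorrelation integrals. -/
theorem vTilde_mul_conj (hi : Integrable v halfLine) (l : ℝ) :
    vTilde v l * conj (vTilde v l) = Phi v (-l) + conj (Phi v (-l)) := by
  rw [← integral_causal_swap hi, ← integral_conj_causal hi, ← integral_add
    (integrable_conj_causal hi _) (integrable_causal_swap hi _), conj_vTilde, vTilde,
    ← integral_prod_mul]
  refine integral_congr_ae ?_
  filter_upwards [ae_prod_ne] with q hq
  rw [mul_mul_mul_comm, ← Complex.exp_add]
  rcases lt_or_gt_of_ne hq with h | h
  · rw [conj_causal_of_lt h, causal_of_le (show q.swap.2 ≤ q.swap.1 from h.le), add_zero]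
    congr 2
    ring
  · rw [causal_of_le h.le, causal_of_lt (show q.swap.1 < q.swap.2 from h), map_zero, zero_add]
    simp only [Prod.fst_swap, Prod.snd_swap]
    congr 2
    push_cast
    ring

/-- In the Green kernel `e^{il(x+t)}` separates variables and gives the product of transforms in
`F`; `e^{il|x-t|}`, split along the diagonal, gives the two `Φ` terms. -/
theorem resolventForm_ofReal (hm : AEStronglyMeasurable v halfLine)
    (hv : IntegrableOn (fun x : ℝ => (1 + x ^ 2) * ‖v x‖ ^ 2) (Ioi (0 : ℝ))) {l : ℝ}
    (hl : l ≠ 0) : resolventForm v l = (2 * Complex.I * l)⁻¹ * F v l := by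
  have hi := integrable_of_weighted hm hv
  have hi1 : Integrable (fun x : ℝ => Complex.exp (Complex.I * l * x) * v x) halfLine := by
    refine hi.bdd_mul (c := 1) (Measurable.aestronglyMeasurable (by fun_prop))
      (ae_of_all _ fun x => (norm_exp_I_mul_real l x).le)
  have hi2 : Integrable (fun x : ℝ => Complex.exp (Complex.I * l * x) * conj (v x)) halfLine := by
    refine Integrable.bdd_mul (c := 1)
      ((RCLike.conjCLE (K := ℂ)).toContinuousLinearMap.integrable_comp hi)
      (Measurable.aestronglyMeasurable (by fun_prop))
      (ae_of_all _ fun x => (norm_exp_I_mul_real l x).le)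
  rw [resolventForm_eq_integral_prod hm hv (by simp) (by exact_mod_cast hl)]
  congr 1
  have hF : F v l = ∫ q : ℝ × ℝ, ((Complex.exp (Complex.I * l * q.1) * v q.1) *
      (Complex.exp (Complex.I * l * q.2) * conj (v q.2)) - causal v l q.swap -
      conj (causal v (-l) q)) ∂(halfLine.prod halfLine) := by
    have hi3 := hi1.mul_prod hi2
    have hi4 : Integrable (fun q : ℝ × ℝ => (Complex.exp (Complex.I * l * q.1) * v q.1) *
        (Complex.exp (Complex.I * l * q.2) * conj (v q.2)) - causal v l q.swap)
        (halfLine.prod halfLine) := hi3.sub (integrable_causal_swap hi l)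
    rw [integral_sub hi4
      (integrable_conj_causal hi _), integral_sub hi3 (integrable_causal_swap hi _),
      integral_prod_mul (fun x : ℝ => Complex.exp (Complex.I * l * x) * v x)
        (fun t : ℝ => Complex.exp (Complex.I * l * t) * conj (v t)),
      integral_causal_swap hi, integral_conj_causal hi, F, vTilde_neg, conj_vTilde]
  rw [hF]
  refine integral_congr_ae ?_
  filter_upwards [ae_prod_ne] with q hq
  rw [mul_mul_mul_comm, ← Complex.exp_add, sub_mul, sub_sub]
  congr 1
  · congr 2
    ring
  rcases lt_or_gt_of_ne hq with h | h
  · rw [conj_causal_of_lt h, causal_of_le (show q.swap.2 ≤ q.swap.1 from h.le), zero_add,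
      abs_of_neg (sub_neg.2 h), neg_sub]
    push_cast
    rfl
  · rw [causal_of_le h.le, causal_of_lt (show q.swap.1 < q.swap.2 from h), map_zero, add_zero,
      abs_of_pos (sub_pos.2 h)]
    push_cast
    rfl

theorem sin_div_eq (l c : ℝ) : ((Real.sin (l * c) / l : ℝ) : ℂ) =
    (2 * Complex.I * l)⁻¹ * (Complex.exp (Complex.I * l * c) -
      Complex.exp (Complex.I * (-l : ℝ) * c)) := by
  have h1 : Complex.I * l * c = (l * c : ℂ) * Complex.I := by ring
  push_cast
  rw [show Complex.I * -(l : ℂ) * c = -(l * c : ℂ) * Complex.I by ring, h1, Complex.sin]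
  by_cases hl : (l : ℂ) = 0
  · simp [hl]
  · field_simp
    rw [Complex.I_sq]
    ring

theorem psi_zero (hi : Integrable v halfLine) (l : ℝ) :
    psi v l 0 = (2 * Complex.I * l)⁻¹ * (vTilde v (-l) - vTilde v l) := by
  have hb : ∀ l : ℝ, Integrable (fun x : ℝ => Complex.exp (Complex.I * l * x) * v x) halfLine :=
    fun l => hi.bdd_mul (c := 1) (Measurable.aestronglyMeasurable (by fun_prop))
      (ae_of_all _ fun x => (norm_exp_I_mul_real l x).le)
  have h2 := vTilde_neg (v := v) (-l)
  rw [neg_neg] at h2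
  rw [psi, vTilde_neg, h2, ← integral_sub (hb l) (hb (-l)), ← integral_const_mul]
  congr 1
  ext t
  rw [sin_div_eq, sub_zero]
  ring

theorem phi_eq (hi : Integrable v halfLine) (l : ℝ) :
    phi v l = (2 * Complex.I * l)⁻¹ * (conj (Phi v l) - conj (Phi v (-l))) := by
  rw [← integral_causal hi, ← integral_causal hi, ← integral_sub (integrable_causal hi _)
    (integrable_causal hi _), integral_prod (fun q => causal v l q - causal v (-l) q)
    ((integrable_causal hi _).sub (integrable_causal hi _)), phi, ← integral_const_mul]
  refine setIntegral_congr_fun measurableSet_Ioi fun x hx => ?_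
  have hx : (0 : ℝ) < x := hx
  rw [psi, ← integral_mul_const, ← integral_const_mul, ← integral_indicator measurableSet_Ioi,
    ← integral_indicator measurableSet_Ioi]
  congr 1
  ext t
  by_cases ht : x < t
  · rw [indicator_of_mem (show t ∈ Ioi x from ht),
      indicator_of_mem (show t ∈ Ioi (0 : ℝ) from hx.trans ht),
      causal_of_lt (show (x, t).1 < (x, t).2 from ht),
      causal_of_lt (show (x, t).1 < (x, t).2 from ht), sin_div_eq]
    push_cast
    ring
  · rw [indicator_of_notMem (show t ∉ Ioi x from ht)]
    simp [indicator, causal_of_le (show (x, t).2 ≤ (x, t).1 from not_lt.1 ht)]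

/-- After `phi` and `psi` are expressed by `Φ` and `ṽ`, the two sides differ by a multiple of the
identity for `|ṽ(l)|²`. -/
theorem jost_zero (hm : AEStronglyMeasurable v halfLine)
    (hv : IntegrableOn (fun x : ℝ => (1 + x ^ 2) * ‖v x‖ ^ 2) (Ioi (0 : ℝ))) {α l : ℝ}
    (hl : l ≠ 0) : jost α v l 0 = -(1 + α * resolventForm v l) := by
  have hi := integrable_of_weighted hm hv
  have h1 := vTilde_mul_conj hi l
  rw [jost, phi_eq hi, psi_zero hi, resolventForm_ofReal hm hv hl, F, Complex.ofReal_zero,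
    mul_zero, Complex.exp_zero]
  linear_combination α * (2 * Complex.I * l)⁻¹ * h1

theorem r_eq (hm : AEStronglyMeasurable v halfLine)
    (hv : IntegrableOn (fun x : ℝ => (1 + x ^ 2) * ‖v x‖ ^ 2) (Ioi (0 : ℝ))) {α l : ℝ}
    (hα : α ≠ 0) (hl : l ≠ 0) :
    r α v l = -(2 * Complex.I * l / α) * (1 + α * resolventForm v l) := by
  have hα : (α : ℂ) ≠ 0 := by exact_mod_cast hα
  have hl' : (l : ℂ) ≠ 0 := by exact_mod_cast hl
  rw [resolventForm_ofReal hm hv hl, r, F]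
  field_simp
  ring

theorem resolventForm_neg (hm : AEStronglyMeasurable v halfLine)
    (hv : IntegrableOn (fun x : ℝ => (1 + x ^ 2) * ‖v x‖ ^ 2) (Ioi (0 : ℝ))) (l : ℝ) :
    resolventForm v (-l : ℝ) = conj (resolventForm v l) := by
  rw [← resolventForm_symm hm hv (by simp)]
  simp

theorem BMinus_eq (hm : AEStronglyMeasurable v halfLine)
    (hv : IntegrableOn (fun x : ℝ => (1 + x ^ 2) * ‖v x‖ ^ 2) (Ioi (0 : ℝ))) {α l : ℝ}
    (hl : l ≠ 0) : BMinus α v l = conj (1 + α * resolventForm v l) := by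
  rw [map_add, map_one, map_mul, Complex.conj_ofReal, ← resolventForm_neg hm hv,
    resolventForm_ofReal hm hv (neg_ne_zero.2 hl), BMinus]
  push_cast
  rw [mul_neg, inv_neg]
  ring

/-- The spectral density of `R₀`. Expanding `|W|²`, the diagonal terms `|ṽ(l)|²` and `|ṽ(-l)|²`
cancel all the `Φ` terms. -/
theorem resolventForm_im (hm : AEStronglyMeasurable v halfLine)
    (hv : IntegrableOn (fun x : ℝ => (1 + x ^ 2) * ‖v x‖ ^ 2) (Ioi (0 : ℝ))) {l : ℝ}
    (hl : l ≠ 0) : (resolventForm v l).im = ‖W v l‖ ^ 2 / (4 * l) := by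
  have hi := integrable_of_weighted hm hv
  have hl' : (l : ℂ) ≠ 0 := by exact_mod_cast hl
  have h1 := vTilde_mul_conj hi l
  have h2 := vTilde_mul_conj hi (-l)
  rw [neg_neg] at h2
  have h3 := resolventForm_ofReal hm hv hl
  have key : ((resolventForm v l).im : ℂ) = ((‖W v l‖ ^ 2 / (4 * l) : ℝ) : ℂ) := by
    rw [Complex.im_eq_sub_conj]
    push_cast
    rw [← Complex.mul_conj', h3, F, W]
    simp only [map_mul, map_inv₀, map_sub, Complex.conj_I, Complex.conj_ofReal, Complex.conj_conj,
      map_ofNat]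
    field_simp
    rw [Complex.I_sq]
    linear_combination 4 * (h1 + h2)
  exact_mod_cast key

end BoundaryValues

/-! ### Plancherel for the sine transform -/

section Plancherel

open FourierTransform SchwartzMap ENNReal

theorem continuous_fourier {f : ℝ → ℂ} (hf : Integrable f) : Continuous (𝓕 f) :=
  VectorFourier.fourierIntegral_continuous Real.continuous_fourierChar
    (L := innerₗ ℝ) continuous_inner hf

theorem integral_schwartz_fourier_smul (φ : 𝓢(ℝ, ℂ)) {f : ℝ → ℂ} (hf : Integrable f) :
    ∫ x, φ x • 𝓕 f x = ∫ x, (𝓕 φ) x • f x := by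
  have := VectorFourier.integral_fourierIntegral_smul_eq_flip (L := innerₗ ℝ)
    (μ := volume) (ν := volume) (e := Real.fourierChar) (f := φ) (g := f)
    Real.continuous_fourierChar continuous_inner φ.integrable hf
  rw [flip_innerₗ] at this
  rw [SchwartzMap.fourier_coe]
  exact this.symm

/-- Identifies the `L²` transform with the integral one: against a smooth compactly supported test
function, both move the transform onto the test function. -/
theorem ae_eq_fourier_toLp {f : ℝ → ℂ} (hf : Integrable f) (hf2 : MemLp f 2) :
    (𝓕 (hf2.toLp f) : Lp ℂ 2 (volume : Measure ℝ)) =ᵐ[volume] 𝓕 f := by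
  refine ae_eq_of_integral_contDiff_smul_eq
    ((Lp.memLp _).locallyIntegrable (by norm_num)) (continuous_fourier hf).locallyIntegrable ?_
  intro g hg hgc
  have hg1 : ContDiff ℝ ((⊤ : ℕ∞) : WithTop ℕ∞) (fun x => (g x : ℂ)) :=
    Complex.ofRealCLM.contDiff.comp hg
  have hg2 : HasCompactSupport (fun x => (g x : ℂ)) :=
    hgc.comp_left (g := fun x : ℝ => (x : ℂ)) Complex.ofReal_zero
  set φ : 𝓢(ℝ, ℂ) := hg2.toSchwartzMap hg1 with hφ
  have hφx : ∀ x, φ x = g x := fun x => rfl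
  have h1 := congrArg (fun T => T φ) (Lp.fourier_toTemperedDistribution_eq (hf2.toLp f))
  simp only [TemperedDistribution.fourier_apply, Lp.toTemperedDistribution_apply] at h1
  have h2 := integral_schwartz_fourier_smul φ hf
  have h3 : ∫ x, (𝓕 φ) x • (hf2.toLp f) x = ∫ x, (𝓕 φ) x • f x := by
    refine integral_congr_ae ?_
    filter_upwards [hf2.coeFn_toLp] with x hx
    rw [hx]
  rw [h3, ← h2] at h1
  exact h1.symm

theorem integral_norm_sq_eq_Lp (f : Lp ℂ 2 (volume : Measure ℝ)) :
    ∫ x, ‖f x‖ ^ 2 = ‖f‖ ^ 2 := by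
  have h := L2.inner_def (𝕜 := ℂ) f f
  rw [inner_self_eq_norm_sq_to_K] at h
  have h2 : ∀ x, inner ℂ (f x) (f x) = ((‖f x‖ ^ 2 : ℝ) : ℂ) := fun x => by
    rw [inner_self_eq_norm_sq_to_K]; norm_cast
  simp only [h2] at h
  rw [integral_complex_ofReal] at h
  refine Complex.ofReal_injective (h.symm.trans ?_)
  simp

/-- Plancherel's theorem for integrable and square integrable functions. -/
theorem plancherel {f : ℝ → ℂ} (hf : Integrable f) (hf2 : MemLp f 2) :
    Integrable (fun x => ‖𝓕 f x‖ ^ 2) ∧ ∫ x, ‖𝓕 f x‖ ^ 2 = ∫ x, ‖f x‖ ^ 2 := by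
  have hae := ae_eq_fourier_toLp hf hf2
  have hm : MemLp (𝓕 f) 2 := (memLp_congr_ae hae).1 (Lp.memLp _)
  refine ⟨(memLp_two_iff_integrable_sq_norm hm.1).1 hm, ?_⟩
  have h1 : ∫ x, ‖𝓕 f x‖ ^ 2 = ‖𝓕 (hf2.toLp f)‖ ^ 2 := by
    rw [← integral_norm_sq_eq_Lp]
    refine integral_congr_ae ?_
    filter_upwards [hae] with x hx
    rw [hx]
  have h2 : ∫ x, ‖f x‖ ^ 2 = ‖hf2.toLp f‖ ^ 2 := by
    rw [← integral_norm_sq_eq_Lp]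
    refine integral_congr_ae ?_
    filter_upwards [hf2.coeFn_toLp] with x hx
    rw [hx]
  rw [h1, h2, Lp.norm_fourier_eq]

theorem W_neg (v : ℝ → ℂ) (l : ℝ) : W v (-l) = -W v l := by
  rw [W, W, neg_neg, neg_sub]

/-- Plancherel's theorem for the sine transform. -/
theorem integral_norm_W_sq {v : ℝ → ℂ} (hi : Integrable v halfLine)
    (hi2 : Integrable (fun x => ‖v x‖ ^ 2) halfLine) :
    IntegrableOn (fun l => ‖W v l‖ ^ 2) (Ioi 0) ∧
      ∫ l in Ioi (0 : ℝ), ‖W v l‖ ^ 2 = 2 * Real.pi * ∫ x in Ioi (0 : ℝ), ‖v x‖ ^ 2 := by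
  set u : ℝ → ℂ := (Ioi (0 : ℝ)).indicator v with hu
  -- `W` is the Fourier transform of the odd extension of `v`; halving the integrals of the even
  -- functions `|W|²` and `|o|²` later returns to the half-line.
  set o : ℝ → ℂ := fun x => u x - u (-x) with ho
  have hui : Integrable u := (integrable_indicator_iff measurableSet_Ioi).2 hi
  have hoi : Integrable o := hui.sub hui.comp_neg
  have hsq : ∀ x, ‖o x‖ ^ 2 = (Ioi (0 : ℝ)).indicator (fun x => ‖v x‖ ^ 2) x +
      (Ioi (0 : ℝ)).indicator (fun x => ‖v x‖ ^ 2) (-x) := by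
    intro x
    rcases lt_trichotomy x 0 with h | rfl | h
    · simp [ho, hu, indicator, h, h.not_gt]
    · simp [ho, hu]
    · simp [ho, hu, indicator, h, h.not_gt]
  have hsi : Integrable ((Ioi (0 : ℝ)).indicator (fun x => ‖v x‖ ^ 2)) :=
    (integrable_indicator_iff measurableSet_Ioi).2 hi2
  have ho2 : MemLp o 2 := by
    rw [memLp_two_iff_integrable_sq_norm hoi.1]
    simp only [hsq]
    exact hsi.add hsi.comp_neg
  obtain ⟨hP1, hP2⟩ := plancherel hoi ho2
  -- The kernel of `𝓕` is `e^{-2πixw}`; this rescaling is the source of the factor `2π`.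
  have hF : ∀ w, 𝓕 o w = W v (2 * Real.pi * w) := by
    intro w
    have hE : ∀ c : ℝ, Integrable (fun x : ℝ => Complex.exp ((c * x : ℝ) * Complex.I) * u x) :=
      fun c => hui.bdd_mul (c := 1) (Measurable.aestronglyMeasurable (by fun_prop))
        (ae_of_all _ fun x => (Complex.norm_exp_ofReal_mul_I _).le)
    have hT : ∀ c : ℝ, vTilde v c = ∫ x : ℝ, Complex.exp ((-c * x : ℝ) * Complex.I) * u x := by
      intro c
      rw [vTilde, ← integral_indicator measurableSet_Ioi]
      congr 1
      ext x
      by_cases hx : 0 < x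
      · simp only [hu, indicator, mem_Ioi, hx, if_true]
        congr 2
        push_cast
        ring
      · simp [hu, hx]
    have hN : ∫ x : ℝ, Complex.exp ((-(2 * Real.pi * w) * x : ℝ) * Complex.I) * u (-x) =
        ∫ x : ℝ, Complex.exp ((-(-(2 * Real.pi * w)) * x : ℝ) * Complex.I) * u x := by
      rw [← integral_neg_eq_self]
      simp
    rw [Real.fourier_real_eq_integral_exp_smul, W, hT, hT, ← hN, ← integral_sub (hE _)]
    · congr 1
      ext x
      rw [ho, smul_eq_mul, ← mul_sub]
      congr 3
      push_cast
      ring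
    · have := (hE (2 * Real.pi * w)).comp_neg
      simpa using this
  simp only [hF] at hP1 hP2
  have hpi : (2 * Real.pi) ≠ 0 := by positivity
  have hW : Integrable (fun l => ‖W v l‖ ^ 2) :=
    (integrable_comp_mul_left_iff (fun l => ‖W v l‖ ^ 2) hpi).1 hP1
  refine ⟨hW.integrableOn, ?_⟩
  rw [Measure.integral_comp_mul_left (fun l => ‖W v l‖ ^ 2), smul_eq_mul,
    abs_of_pos (by positivity)] at hP2
  have heven : ∫ l, ‖W v l‖ ^ 2 = 2 * ∫ l in Ioi (0 : ℝ), ‖W v l‖ ^ 2 := by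
    rw [← integral_comp_abs (f := fun l => ‖W v l‖ ^ 2)]
    congr 1
    ext l
    rcases abs_cases l with h | h
    · rw [h.1]
    · rw [h.1, W_neg, norm_neg]
  have hodd : ∫ x, ‖o x‖ ^ 2 = 2 * ∫ x in Ioi (0 : ℝ), ‖v x‖ ^ 2 := by
    simp only [hsq]
    rw [integral_add hsi hsi.comp_neg, integral_neg_eq_self
      ((Ioi (0 : ℝ)).indicator (fun x => ‖v x‖ ^ 2)), integral_indicator measurableSet_Ioi]
    ring
  rw [heven, hodd] at hP2
  field_simp at hP2
  linarith

end Plancherel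

/-! ### Uniqueness of the phase and the scattering function -/

section Phase

open ComplexConjugate

variable {α : ℝ} {v : ℝ → ℂ}

theorem isResolventLike_resolventForm (hα : 0 < α) (hm : AEStronglyMeasurable v halfLine)
    (hv : IntegrableOn (fun x : ℝ => (1 + x ^ 2) * ‖v x‖ ^ 2) (Ioi (0 : ℝ)))
    (hr : ∀ l : ℝ, l ≠ 0 → r α v l ≠ 0) :
    IsResolventLike fun z => α * resolventForm v z where
  continuousOn := continuousOn_const.mul (continuousOn_resolventForm hm hv)
  differentiableOn := (differentiableOn_resolventForm hm hv).const_mul _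
  bound := by
    obtain ⟨C, hC⟩ := resolventForm_bound hm hv
    refine ⟨α * C, fun z hz => ?_⟩
    rw [norm_mul, Complex.norm_real, Real.norm_of_nonneg hα.le, mul_div_assoc]
    exact mul_le_mul_of_nonneg_left (hC z hz) hα.le
  symm := fun z hz => by rw [resolventForm_symm hm hv hz, map_mul, Complex.conj_ofReal]
  imag_re := fun y hy => by
    rw [Complex.re_ofReal_mul]
    exact mul_nonneg hα.le (resolventForm_imag_re_nonneg hm hv hy)
  real_im := fun x hx => by
    rw [Complex.im_ofReal_mul, resolventForm_im hm hv hx.ne']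
    positivity
  ne_zero := fun x hx h => hr x hx (by rw [r_eq hm hv hα.ne' hx, h, mul_zero])

theorem IsPhase.unique {ζ ζ' : ℝ → ℝ} (h : IsPhase α v ζ) (h' : IsPhase α v ζ') : ζ' = ζ := by
  set d : ℝ → ℝ := fun l => |ζ' l - ζ l| with hd
  have hdc : Continuous d := (h'.1.sub h.1).abs
  have hdt : Tendsto d (cocompact ℝ) (𝓝 0) := by
    have := (h'.2.1.sub h.2.1).abs
    simpa using this
  have hsin0 : ∀ l : ℝ, l ≠ 0 → Real.sin (ζ' l - ζ l) = 0 := by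
    intro l hl
    have e := (h'.2.2 l hl).symm.trans (h.2.2 l hl)
    obtain ⟨n, hn⟩ := Complex.exp_eq_exp_iff_exists_int.1 e
    have hn' : ((ζ' l - ζ l : ℝ) : ℂ) = ((-n * Real.pi : ℝ) : ℂ) := by
      have h2 : (2 * Complex.I) ≠ 0 := by simp
      refine mul_left_cancel₀ h2 ?_
      push_cast
      linear_combination -hn
    rw [Complex.ofReal_injective hn', neg_mul, Real.sin_neg, Real.sin_int_mul_pi, neg_zero]
  have hsin : ∀ l : ℝ, Real.sin (ζ' l - ζ l) = 0 := by
    have hc : Continuous fun l => Real.sin (ζ' l - ζ l) := Real.continuous_sin.comp (h'.1.sub h.1)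
    have := Continuous.ext_on (dense_compl_singleton (0 : ℝ)) hc continuous_const
      (fun l hl => hsin0 l hl)
    exact fun l => congrFun this l
  have hsmall : ∀ l, d l < Real.pi / 2 := by
    intro l
    by_contra hl
    rw [not_lt] at hl
    obtain ⟨m, hm⟩ := (hdt.eventually_lt_const (half_pos Real.pi_pos)).exists
    -- Since `d` is small far out, reaching `π/2` would force the exact value `π/2` somewhere, where
    -- the sine is `±1` instead of `0`.
    obtain ⟨x, hx⟩ := mem_range_of_exists_le_of_exists_ge hdc ⟨m, hm.le⟩ ⟨l, hl⟩
    have h1 := hsin x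
    rcases abs_choice (ζ' x - ζ x) with h2 | h2
    · rw [← h2] at h1
      change Real.sin (d x) = 0 at h1
      rw [hx, Real.sin_pi_div_two] at h1
      exact one_ne_zero h1
    · rw [← neg_eq_zero, ← Real.sin_neg, ← h2] at h1
      change Real.sin (d x) = 0 at h1
      rw [hx, Real.sin_pi_div_two] at h1
      exact one_ne_zero h1
  ext l
  have h1 := hsmall l
  have h2 := abs_lt.1 h1
  have := (Real.sin_eq_zero_iff_of_lt_of_lt (by linarith [Real.pi_pos])
    (by linarith [Real.pi_pos])).1 (hsin l)
  linarith

theorem S_eq (hm : AEStronglyMeasurable v halfLine)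
    (hv : IntegrableOn (fun x : ℝ => (1 + x ^ 2) * ‖v x‖ ^ 2) (Ioi (0 : ℝ))) {l : ℝ}
    (hl : l ≠ 0) :
    S α v l = conj (1 + α * resolventForm v l) / (1 + α * resolventForm v l) := by
  rw [S, jost_zero hm hv hl, jost_zero hm hv (neg_ne_zero.2 hl), resolventForm_neg hm hv,
    neg_div_neg_eq]
  simp

end Phase

end NonlocalScattering

/-! ### The phase, the formula for `|W|²` and the coupling constant -/

theorem theorem4p1 (α : ℝ) (v : ℝ → ℂ) (hα : 0 < α)
    (hmeas : AEStronglyMeasurable v (volume.restrict (Ioi (0 : ℝ))))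
    (hv : IntegrableOn (fun x : ℝ => (1 + x ^ 2) * ‖v x‖ ^ 2) (Ioi (0 : ℝ)))
    (hr : ∀ l : ℝ, l ≠ 0 → NonlocalScattering.r α v l ≠ 0) :
    ∃ ζ : ℝ → ℝ,
      NonlocalScattering.IsPhase α v ζ ∧
      (∀ ζ' : ℝ → ℝ, NonlocalScattering.IsPhase α v ζ' → ζ' = ζ) ∧
      (∀ l : ℝ, l ≠ 0 → NonlocalScattering.BMinus α v l =
        ‖NonlocalScattering.BMinus α v l‖ * Complex.exp (-(Complex.I * ζ l))) ∧
      ∃ H : ℝ → ℝ,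
        (∀ l : ℝ, NonlocalScattering.HasCauchyPV ζ l (H l)) ∧
        (∀ l : ℝ, ‖NonlocalScattering.W v l‖ ^ 2 =
          4 * l / α * Real.sin (ζ l) * Real.exp (1 / Real.pi * H l)) ∧
        ((∫ x in Ioi (0 : ℝ), ‖v x‖ ^ 2) = 1 →
          IntegrableOn (fun l : ℝ => l * Real.sin (ζ l) * Real.exp (1 / Real.pi * H l))
            (Ioi (0 : ℝ)) ∧
          α = 2 / Real.pi * ∫ l in Ioi (0 : ℝ),
            l * Real.sin (ζ l) * Real.exp (1 / Real.pi * H l)) := by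
  open NonlocalScattering ComplexConjugate in
  have hP := isResolventLike_resolventForm hα hmeas hv hr
  set h : ℂ → ℂ := IsResolventLike.boundaryLog fun z => α * resolventForm v z with hh
  have hexp : ∀ l : ℝ, Complex.exp (h l) = 1 + α * resolventForm v l := fun l =>
    hP.exp_boundaryLog (by simp)
  obtain ⟨C, hC⟩ := hP.norm_boundaryLog_bound
  have hphase : IsPhase α v fun l => (h l).im := by
    refine ⟨Complex.continuous_im.comp (continuous_ofReal_of_upper hP.continuousOn_boundaryLog),
      ?_, fun l hl => ?_⟩
    · refine squeeze_zero_norm (a := fun l : ℝ => C / (1 + ‖l‖)) (fun l => ?_) ?_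
      · rw [Real.norm_eq_abs]
        refine (Complex.abs_im_le_norm _).trans ?_
        have := hC l (by simp)
        rwa [Complex.norm_real] at this
      · exact tendsto_const_nhds.div_atTop
          (tendsto_atTop_add_const_left _ _ (tendsto_norm_cocompact_atTop (E := ℝ)))
    · rw [S_eq hmeas hv hl, ← hexp, ← Complex.exp_conj, ← Complex.exp_sub]
      congr 1
      apply Complex.ext <;> simp
      ring
  -- With the principal value equal to `π Re h`, the left side is `Im e^h`.
  have hsin : ∀ l : ℝ, Real.sin (h l).im * Real.exp (1 / Real.pi * (Real.pi * (h l).re)) =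
      α * (resolventForm v l).im := by
    intro l
    have := congrArg Complex.im (hexp l)
    rw [Complex.exp_im, Complex.add_im, Complex.one_im, zero_add, Complex.im_ofReal_mul] at this
    rw [← this, ← mul_assoc, one_div_mul_cancel Real.pi_ne_zero, one_mul, mul_comm]
  have hW : ∀ l : ℝ, ‖W v l‖ ^ 2 = 4 * l / α * Real.sin (h l).im *
      Real.exp (1 / Real.pi * (Real.pi * (h l).re)) := by
    intro l
    rw [mul_assoc, hsin]
    -- The formula for `Im P` divides by `l`; at the origin `W` and the factor `4l` both vanish.
    by_cases hl : l = 0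
    · simp [hl, W]
    · rw [resolventForm_im hmeas hv hl]
      field_simp
  refine ⟨fun l => (h l).im, hphase, fun ζ' hζ' => hphase.unique hζ', fun l hl => ?_,
    fun l => Real.pi * (h l).re,
    fun l => hasCauchyPV_im hP.continuousOn_boundaryLog hP.differentiableOn_boundaryLog hC l,
    hW, fun hnorm => ?_⟩
  · rw [BMinus_eq hmeas hv hl, ← hexp, RCLike.norm_conj, Complex.norm_exp, Complex.ofReal_exp,
      ← Complex.exp_conj, ← Complex.exp_add]
    congr 1
    apply Complex.ext <;> simp
  · obtain ⟨h1, h2⟩ := integral_norm_W_sq (integrable_of_weighted hmeas hv)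
      (integrable_sq_of_weighted hmeas hv)
    have he : ∀ l : ℝ, l * Real.sin (h l).im * Real.exp (1 / Real.pi * (Real.pi * (h l).re)) =
        α / 4 * ‖W v l‖ ^ 2 := fun l => by
      rw [hW l]
      field_simp
    simp only [he]
    refine ⟨h1.const_mul _, ?_⟩
    rw [integral_const_mul, h2, hnorm]
    field_simp
    norm_num
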